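/- A choice function is a map $\langle\cdot\rangle:\mathbb C\setminus\{0\}\to\mathbb Z[i]$ with $|z-\langle z\rangle|\le 1$ for all $z$. Its fundamental set is $K=\overline{\{z-\langle z\rangle : z\ne 0\}}$, and its Gauss map $G:K\to K$ is $G(z)=S(z)-\langle S(z)\rangle$ for $z\neq0$, $G(0)=0$, where $S(z)=-1/z$. A partition of $K$ is a finite family of distinct nonempty closed sets $K_1,\dots,K_N$ with union $K$, whose boundaries have Lebesgue measure zero and whose interiors are pairwise disjoint. The algorithm satisfies the finite building property with the partition $\{K_1,\dots,K_N\}$ if $N>1$ and each $G(K_i)$ is equal, up to Lebesgue measure zero, to a union of some of the sets $K_1,\dots,K_N$. A shifted Hurwitz algorithm is given by a function $\langle\cdot\rangle$ that assigns to each $z\ne0$ a Gaussian integer $h$ with $|z-h|\le1$ for which $|z-h+\tfrac12|$ is minimal among all such $h$ (ties being broken arbitrarily). Let $$\begin{aligned} K_1&=\{z\in K: -\tfrac12\le \operatorname{Re}z\le 0,\ |z-i|\ge1,\ |z+i|\ge1\},\\ K_2&=\{z\in K: |z-i|\le1,\ |z+1|\le1,\ |z-(-1+i)|\ge1\},\\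 K_3&=\{z\in K: 0\le\operatorname{Im}z\le\tfrac12,\ |z-1|\ge1,\ |z+1|\ge1\},\\ K_4&=\{z\in K: \operatorname{Re}z\ge-\tfrac12,\ |z-(-1+i)|\le1\},\\ K_5&=\{z\in K: \operatorname{Re}z\le-\tfrac12,\ |z-(-1+i)|\le1\},\\ K_6&=\{z\in K: \operatorname{Re}z\le-\tfrac12,\ |z-(-1+i)|\ge1,\ |z-(-1-i)|\ge1\},\\ K_i&=\{\overline z: z\in K_{i-5}\}\qquad (i=7,8,9,10). \end{aligned}$$ Proposition. Functions $\langle\cdot\rangle$ as above exist. For every such function, $\langle\cdot\rangle$ is a choice function, $G$ maps $K$ into $K$, and the algorithm satisfies the finite building property with the partition $\{K_1,\dots,K_{10}\}$. Moreover, writing $K_J=\bigcup_{j\in J}K_j$ and $S(K_i)$ for $S(K_i\setminus\{0\})$, and with $m,n$ ranging over integers, $$\begin{aligned} S(K_1)&=(2+K_{\{3,8\}})\cup\bigcup_{n\ge3}(n+K),\\ S(K_2)&=(2+i+K_{\{3,8\}})\cup(1+2i+K_{\{1,2,3,4\}})\cup(2+2i+K_{\{1,\dots,8\}})\\ &\quad\cup\bigcup_{m\ge3}(1+mi+K_{\{1,2,3,4,7,8,9\}})\cup\bigcup_{m\ge3}(2+mi+K)\cup\bigcup_{n\ge3,\,m\ge1}(n+mi+K),\\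 S(K_3)&=(2i+K_{\{1,2,3,4\}})\cup(1+2i+K_{\{5,6\}})\cup\bigcup_{m\ge3}(mi+K_{\{1,2,3,4,7,8,9\}})\cup\bigcup_{m\ge3}(1+mi+K_{\{5,6,10\}}),\\ S(K_4)&=(1+i+K_3)\cup(2+i+K_{\{1,2,4,5,6,7\}})\cup(1+2i+K_{\{7,8\}})\cup(2+2i+K_{\{9,10\}}),\\ S(K_5)&=(1+K_3)\cup(2+K_{\{4,5\}})\cup(1+i+K_8)\cup(2+i+K_{\{9,10\}}),\\ S(K_6)&=2+K_{\{1,2,6,7\}}, \end{aligned}$$ and for $7\le i\le10$, $S(K_i)$ is the union of the translates $\overline a+K_{\sigma(j)}$ over all translates $a+K_j$ listed for $S(K_{i-5})$, where $\sigma$ fixes $1$ and $6$ and interchanges $j$ and $j+5$ for $2\le j\le5$. -/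

import Mathlib

open MeasureTheory Set

noncomputable section

namespace ComplexCF

/-! ### Choice functions, fundamental sets, Gauss maps -/

/-- A choice function `ℂ ∖ {0} → ℤ[i]` with `|z - ⟨z⟩| ≤ 1`. It is encoded as a total function whose
value at `0` is never used. -/
def IsChoiceFunction (c : ℂ → GaussianInt) : Prop :=
  ∀ z : ℂ, z ≠ 0 → ‖z - (c z : ℂ)‖ ≤ 1

/-- The fundamental set `K`, the closure of `{z - ⟨z⟩}`. -/
def fundamentalSet (c : ℂ → GaussianInt) : Set ℂ :=
  closure {w : ℂ | ∃ z : ℂ, z ≠ 0 ∧ w = z - (c z : ℂ)}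

/-- `S(z) = -1/z`. -/
def S (z : ℂ) : ℂ := -1 / z

/-- The Gauss map `G(z) = S(z) - ⟨S(z)⟩` for `z ≠ 0`, and `G(0) = 0`. -/
def gaussMap (c : ℂ → GaussianInt) (z : ℂ) : ℂ :=
  if z = 0 then 0 else S z - (c (S z) : ℂ)

/-! ### The finite building property -/

/-- A set is buildable from a collection if it is equal, up to a set of Lebesgue measure zero, to some
union of members of the collection. -/
def IsBuildable (C : Set (Set ℂ)) (A : Set ℂ) : Prop :=
  ∃ D : Set (Set ℂ), D ⊆ C ∧ A =ᵐ[volume] ⋃₀ D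

/-- A partition of `K` into `N` distinct nonempty closed sets with null boundaries: the pieces
cover `K`, and their interiors are pairwise disjoint. -/
structure IsFinitePartition (K : Set ℂ) {N : ℕ} (P : Fin N → Set ℂ) : Prop where
  injective : Function.Injective P
  nonempty : ∀ i, (P i).Nonempty
  closed : ∀ i, IsClosed (P i)
  null_frontier : ∀ i, volume (frontier (P i)) = 0
  cover : ⋃ i, P i = K
  disjoint_interior : ∀ i j, i ≠ j → Disjoint (interior (P i)) (interior (P j))

/-- The algorithm with choice function `c` satisfies the finite building property with the
partition `P` of its fundamental set. -/
structure FiniteBuildingPropertyWith (c : ℂ → GaussianInt) {N : ℕ} (P : Fin N → Set ℂ) :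
    Prop where
  one_lt : 1 < N
  partition : IsFinitePartition (fundamentalSet c) P
  buildable : ∀ i, IsBuildable (range P) (gaussMap c '' P i)

/-! ### The shifted Hurwitz algorithm -/

/-- `c` chooses, for every `z ≠ 0`, a Gaussian integer `h` in the closed unit disk around `z` for
which `|z - h - d|` is minimal (ties may be broken in any way). -/
def IsDaniNogueiraChoice (d : ℂ) (c : ℂ → GaussianInt) : Prop :=
  ∀ z : ℂ, z ≠ 0 → ‖z - (c z : ℂ)‖ ≤ 1 ∧
    ∀ h : GaussianInt, ‖z - (h : ℂ)‖ ≤ 1 → ‖z - (c z : ℂ) - d‖ ≤ ‖z - (h : ℂ) - d‖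

/-- The shifted Hurwitz algorithm: `d = -1/2`. -/
def IsShiftedHurwitz (c : ℂ → GaussianInt) : Prop :=
  IsDaniNogueiraChoice (-1 / 2) c

/-- The pieces `K₁, …, K₆`. -/
def upperPiece (K : Set ℂ) : ℕ → Set ℂ
  | 1 => {z ∈ K | -1 / 2 ≤ z.re ∧ z.re ≤ 0 ∧ 1 ≤ ‖z - Complex.I‖ ∧ 1 ≤ ‖z + Complex.I‖}
  | 2 => {z ∈ K | ‖z - Complex.I‖ ≤ 1 ∧ ‖z + 1‖ ≤ 1 ∧ 1 ≤ ‖z - (-1 + Complex.I)‖}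
  | 3 => {z ∈ K | 0 ≤ z.im ∧ z.im ≤ 1 / 2 ∧ 1 ≤ ‖z - 1‖ ∧ 1 ≤ ‖z + 1‖}
  | 4 => {z ∈ K | -1 / 2 ≤ z.re ∧ ‖z - (-1 + Complex.I)‖ ≤ 1}
  | 5 => {z ∈ K | z.re ≤ -1 / 2 ∧ ‖z - (-1 + Complex.I)‖ ≤ 1}
  | 6 => {z ∈ K | z.re ≤ -1 / 2 ∧ 1 ≤ ‖z - (-1 + Complex.I)‖ ∧ 1 ≤ ‖z - (-1 - Complex.I)‖}
  | _ => ∅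

/-- The pieces `K₁, …, K₁₀`, where `Kᵢ` is the complex conjugate of `Kᵢ₋₅` for `7 ≤ i ≤ 10`
(only the indices `1, …, 10` are used). -/
def piece (K : Set ℂ) (i : ℕ) : Set ℂ :=
  if i ≤ 6 then upperPiece K i else (starRingEnd ℂ) '' upperPiece K (i - 5)

/-- All pairs `(n + m i, j)` with `j ∈ J`, standing for the translates `n + m i + K_j`. -/
def block (n m : ℤ) (J : Finset ℕ) : Set (GaussianInt × ℕ) :=
  {p | p.1 = ⟨n, m⟩ ∧ p.2 ∈ J}

/-- The translates `a + K_j` that make up `S(Kᵢ)`, for `1 ≤ i ≤ 6`. -/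
def upperTranslates : ℕ → Set (GaussianInt × ℕ)
  | 1 => block 2 0 {3, 8} ∪ ⋃ (n : ℤ) (_ : 3 ≤ n), block n 0 (Finset.Icc 1 10)
  | 2 => block 2 1 {3, 8} ∪ block 1 2 {1, 2, 3, 4} ∪ block 2 2 (Finset.Icc 1 8) ∪
      (⋃ (m : ℤ) (_ : 3 ≤ m), block 1 m {1, 2, 3, 4, 7, 8, 9}) ∪
      (⋃ (m : ℤ) (_ : 3 ≤ m), block 2 m (Finset.Icc 1 10)) ∪
      (⋃ (n : ℤ) (_ : 3 ≤ n) (m : ℤ) (_ : 1 ≤ m), block n m (Finset.Icc 1 10))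
  | 3 => block 0 2 {1, 2, 3, 4} ∪ block 1 2 {5, 6} ∪
      (⋃ (m : ℤ) (_ : 3 ≤ m), block 0 m {1, 2, 3, 4, 7, 8, 9}) ∪
      (⋃ (m : ℤ) (_ : 3 ≤ m), block 1 m {5, 6, 10})
  | 4 => block 1 1 {3} ∪ block 2 1 {1, 2, 4, 5, 6, 7} ∪ block 1 2 {7, 8} ∪ block 2 2 {9, 10}
  | 5 => block 1 0 {3} ∪ block 2 0 {4, 5} ∪ block 1 1 {8} ∪ block 2 1 {9, 10}
  | 6 => block 2 0 {1, 2, 6, 7}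
  | _ => ∅

/-- The index of the complex conjugate of `K_j`: it fixes `1` and `6` and interchanges `j` and
`j + 5` for `2 ≤ j ≤ 5`. -/
def conjIndex (j : ℕ) : ℕ :=
  if j = 1 ∨ j = 6 then j else if j ≤ 5 then j + 5 else j - 5

/-- The translates `a + K_j` that make up `S(Kᵢ)`, for `1 ≤ i ≤ 10`; for `7 ≤ i ≤ 10` they are the
complex conjugates of those for `i - 5`. -/
def translates (i : ℕ) : Set (GaussianInt × ℕ) :=
  if i ≤ 6 then upperTranslates i
  else (fun p : GaussianInt × ℕ => (star p.1, conjIndex p.2)) '' upperTranslates (i - 5)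

end ComplexCF

end

namespace ComplexCF

/-! Minimality of |z - h + 1/2| against the competitors h + 1 and h ± i confines every remainder to
the region |z| ≤ 1, |z - 1| ≥ 1, |Im z| ≤ 1/2 (`InK`). On its open core the choice is forced
(`IsShiftedHurwitz.eq_of_inCore`), and the core is dense in the region, so the region is K whatever
the tie-breaking (`IsShiftedHurwitz.fundamentalSet_eq`).

All pieces are cut out by signs of polynomials a|z|² + bx + cy + d. Since S only permutes the
coefficients up to sign (`quad_S`), each S(K_i) is an explicit region `InSUpper i`. Gaussian
translates of K cover the plane: round Im to find a row, then shift within the row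
(`exists_sub_inK`). Locating a point of S(K_i) in this covering and reading off which inequalities
survive gives the listed translates; conversely each listed translate satisfies the inequalities of
S(K_i) (`inSUpper_iff_covered`). Conjugation gives the lower pieces.

If S(z) = a + y with y in the core, then G(z) = y. The points of K outside the core lie on finitely
many circles and lines, so up to measure zero G(K_i) is the union of the K_j occurring in the list
for S(K_i) (`IsShiftedHurwitz.isBuildable`). -/

/-! ### Real coordinates for K and its pieces, and the covering by translates -/

/-- The real quadratic polynomials whose zero sets are circles and lines. -/
def quad (a b c d x y : ℝ) : ℝ := a * (x ^ 2 + y ^ 2) + b * x + c * y + d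

/-- The fundamental set of the shifted Hurwitz algorithm in real coordinates:
`|z| ≤ 1`, `|z - 1| ≥ 1` and `|Im z| ≤ 1 / 2`. -/
def InK (x y : ℝ) : Prop :=
  0 ≤ quad (-1) 0 0 1 x y ∧ 0 ≤ quad 1 (-2) 0 0 x y ∧
    0 ≤ quad 0 0 1 (1 / 2) x y ∧ 0 ≤ quad 0 0 (-1) (1 / 2) x y

/-- The pieces `K₁, …, K₆` in real coordinates. -/
def InUpper : ℕ → ℝ → ℝ → Prop
  | 1, x, y => InK x y ∧ 0 ≤ quad 0 1 0 (1 / 2) x y ∧ 0 ≤ quad 0 (-1) 0 0 x y ∧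
      0 ≤ quad 1 0 (-2) 0 x y ∧ 0 ≤ quad 1 0 2 0 x y
  | 2, x, y => InK x y ∧ 0 ≤ quad (-1) 0 2 0 x y ∧ 0 ≤ quad (-1) (-2) 0 0 x y ∧
      0 ≤ quad 1 2 (-2) 1 x y
  | 3, x, y => InK x y ∧ 0 ≤ quad 0 0 1 0 x y ∧ 0 ≤ quad 0 0 (-1) (1 / 2) x y ∧
      0 ≤ quad 1 (-2) 0 0 x y ∧ 0 ≤ quad 1 2 0 0 x y
  | 4, x, y => InK x y ∧ 0 ≤ quad 0 1 0 (1 / 2) x y ∧ 0 ≤ quad (-1) (-2) 2 (-1) x y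
  | 5, x, y => InK x y ∧ 0 ≤ quad 0 (-1) 0 (-1 / 2) x y ∧ 0 ≤ quad (-1) (-2) 2 (-1) x y
  | 6, x, y => InK x y ∧ 0 ≤ quad 0 (-1) 0 (-1 / 2) x y ∧ 0 ≤ quad 1 2 (-2) 1 x y ∧
      0 ≤ quad 1 2 2 1 x y
  | _, _, _ => False

/-- The pieces `K₁, …, K₁₀` in real coordinates. -/
def InPiece (i : ℕ) (x y : ℝ) : Prop :=
  if i ≤ 6 then InUpper i x y else InUpper (i - 5) x (-y)

theorem InPiece.inK {i : ℕ} {x y : ℝ} (h : InPiece i x y) : InK x y := by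
  have key : ∀ (i : ℕ) (x y : ℝ), InUpper i x y → InK x y := by
    intro i x y h
    unfold InUpper at h
    split at h <;> first | exact h.1 | exact h.elim
  unfold InPiece at h
  split at h
  · exact key _ _ _ h
  · obtain ⟨h1, h2, h3, h4⟩ := key _ _ _ h
    refine ⟨?_, ?_, ?_, ?_⟩ <;> simp only [quad] at * <;> linarith

theorem InK.neg {x y : ℝ} (h : InK x y) : InK x (-y) := by
  obtain ⟨h1, h2, h3, h4⟩ := h
  refine ⟨?_, ?_, ?_, ?_⟩ <;> simp only [quad] at * <;> linarith

/-- The rightmost points are the corners where |z - 1| = 1 meets |Im z| = 1/2, with real part 1 -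
√3/2 ≈ 0.134; 1/7 is a rational bound just above. -/
theorem InK.re_le {x y : ℝ} (h : InK x y) : x ≤ 1 / 7 := by
  obtain ⟨h1, h2, h3, h4⟩ := h
  simp only [quad] at *
  have hy : y ^ 2 ≤ 1 / 4 := by nlinarith
  have hx : x ≤ 1 := by nlinarith [sq_nonneg y]
  by_contra! hc
  nlinarith

theorem InK.neg_one_le_re {x y : ℝ} (h : InK x y) : -1 ≤ x := by
  have h1 := h.1
  simp only [quad] at *
  nlinarith [sq_nonneg y]

/-- Near the cusp at the origin. -/
theorem cusp_eq_zero {x y : ℝ} (hx : -1 / 2 ≤ x) (hx' : x ≤ 1 / 2) (hy : -1 / 2 ≤ y) (hy' : y ≤ 1 / 2)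
    (h1 : 2 * x ≤ x ^ 2 + y ^ 2) (h2 : -2 * x ≤ x ^ 2 + y ^ 2)
    (h3 : 2 * y ≤ x ^ 2 + y ^ 2) (h4 : -2 * y ≤ x ^ 2 + y ^ 2) : x = 0 ∧ y = 0 := by
  have a1 : 2 * |x| ≤ x ^ 2 + y ^ 2 := by rcases abs_cases x with h | h <;> linarith
  have a2 : 2 * |y| ≤ x ^ 2 + y ^ 2 := by rcases abs_cases y with h | h <;> linarith
  have b1 : |x| ≤ 1 / 2 := abs_le.2 ⟨by linarith, hx'⟩
  have b2 : |y| ≤ 1 / 2 := abs_le.2 ⟨by linarith, hy'⟩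
  have c1 := abs_nonneg x
  have c2 := abs_nonneg y
  rw [← sq_abs x, ← sq_abs y] at a1 a2
  -- Adding the two bounds gives |x| + |y| ≤ x² + y², while x² ≤ |x|/2 and y² ≤ |y|/2.
  have : |x| + |y| ≤ 0 := by nlinarith
  exact ⟨abs_eq_zero.1 (by linarith), abs_eq_zero.1 (by linarith)⟩

/-- Every point of `K` in the upper half plane lies in one of `K₁, …, K₆`, with a choice of the
piece that resolves ties. -/
theorem InK.upper_cases {x y : ℝ} (h : InK x y) (hy : 0 ≤ y) :
    (0 < quad 1 2 0 0 x y ∧ InPiece 3 x y) ∨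
    (quad 1 2 0 0 x y ≤ 0 ∧ quad 1 2 (-2) 1 x y < 0 ∧ -1 / 2 ≤ x ∧ InPiece 4 x y) ∨
    (quad 1 2 0 0 x y ≤ 0 ∧ quad 1 2 (-2) 1 x y < 0 ∧ x < -1 / 2 ∧ InPiece 5 x y) ∨
    (quad 1 2 0 0 x y ≤ 0 ∧ x < -1 / 2 ∧ InPiece 6 x y) ∨
    (quad 1 2 0 0 x y ≤ 0 ∧ -1 / 2 ≤ x ∧ InPiece 2 x y) ∨
    (quad 1 2 0 0 x y ≤ 0 ∧ -1 / 2 ≤ x ∧ InPiece 1 x y) := by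
  have hK := h
  obtain ⟨h1, h2, h3, h4⟩ := h
  simp only [InPiece, InUpper, quad, hK, true_and] at *
  norm_num only [if_true]
  rcases lt_or_ge 0 (1 * (x ^ 2 + y ^ 2) + 2 * x + 0 * y + 0) with a | a
  · left; refine ⟨by linarith, ?_, ?_, ?_, ?_⟩ <;> linarith
  right
  rcases lt_or_ge (1 * (x ^ 2 + y ^ 2) + 2 * x + -2 * y + 1) 0 with b | b
  · rcases lt_or_ge x (-1 / 2) with c | c
    · right; left; refine ⟨?_, ?_, ?_, ?_, ?_⟩ <;> linarith
    · left; refine ⟨?_, ?_, ?_, ?_, ?_⟩ <;> linarith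
  right; right
  rcases lt_or_ge x (-1 / 2) with c | c
  · left; refine ⟨?_, ?_, ?_, ?_, ?_⟩ <;> linarith
  right
  rcases le_total (1 * (x ^ 2 + y ^ 2) + 0 * x + -2 * y + 0) 0 with b | b
  · left; refine ⟨?_, ?_, ?_, ?_, ?_⟩ <;> linarith
  · right; refine ⟨?_, ?_, ?_, ?_, ?_, ?_⟩ <;> nlinarith [sq_nonneg y, sq_nonneg x]

/-- `conjIndex` is an involution, so one implication suffices; only the self-conjugate pieces 1 and
6 need an argument beyond unfolding. -/
theorem InPiece.conj {j : ℕ} (hj : j ∈ Finset.Icc 1 10) {x y : ℝ} :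
    InPiece (conjIndex j) x y ↔ InPiece j x (-y) := by
  have key : ∀ j ∈ Finset.Icc 1 10, ∀ x y : ℝ, InPiece j x y → InPiece (conjIndex j) x (-y) := by
    intro j hj x y h
    obtain ⟨a, b⟩ := Finset.mem_Icc.1 hj
    have hK := h.inK
    interval_cases j
    · obtain ⟨-, h1, h2, h3, h4⟩ := h
      refine ⟨hK.neg, ?_, ?_, ?_, ?_⟩ <;> simp only [quad] at * <;> linarith
    iterate 4 simpa [InPiece, conjIndex] using h
    · obtain ⟨-, h1, h2, h3⟩ := h
      refine ⟨hK.neg, ?_, ?_, ?_⟩ <;> simp only [quad] at * <;> linarith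
    all_goals simpa [InPiece, conjIndex] using h
  have hinv : conjIndex (conjIndex j) = j ∧ conjIndex j ∈ Finset.Icc 1 10 := by
    obtain ⟨a, b⟩ := Finset.mem_Icc.1 hj
    interval_cases j <;> simp [conjIndex]
  constructor
  · intro h
    have := key _ hinv.2 _ _ h
    rwa [hinv.1] at this
  · intro h
    have := key _ hj _ _ h
    rwa [neg_neg] at this

/-- Every point of `K` in the lower half plane lies in one of `K₁, K₆, …, K₁₀`, with a choice of the
piece that resolves ties. -/
theorem InK.lower_cases {x y : ℝ} (h : InK x y) (hy : y ≤ 0) :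
    (0 < quad 1 2 0 0 x y ∧ InPiece 8 x y) ∨
    (quad 1 2 0 0 x y ≤ 0 ∧ quad 1 2 2 1 x y < 0 ∧ -1 / 2 ≤ x ∧ InPiece 9 x y) ∨
    (quad 1 2 0 0 x y ≤ 0 ∧ quad 1 2 2 1 x y < 0 ∧ x < -1 / 2 ∧ InPiece 10 x y) ∨
    (quad 1 2 0 0 x y ≤ 0 ∧ x < -1 / 2 ∧ InPiece 6 x y) ∨
    (quad 1 2 0 0 x y ≤ 0 ∧ -1 / 2 ≤ x ∧ InPiece 7 x y) ∨
    (quad 1 2 0 0 x y ≤ 0 ∧ -1 / 2 ≤ x ∧ InPiece 1 x y) := by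
  have H := h.neg.upper_cases (neg_nonneg.2 hy)
  have e1 : quad 1 2 0 0 x (-y) = quad 1 2 0 0 x y := by simp only [quad]; ring
  have e2 : quad 1 2 (-2) 1 x (-y) = quad 1 2 2 1 x y := by simp only [quad]; ring
  rw [e1, e2] at H
  simp only [← InPiece.conj (show 3 ∈ Finset.Icc 1 10 by decide),
    ← InPiece.conj (show 4 ∈ Finset.Icc 1 10 by decide),
    ← InPiece.conj (show 5 ∈ Finset.Icc 1 10 by decide),
    ← InPiece.conj (show 6 ∈ Finset.Icc 1 10 by decide),
    ← InPiece.conj (show 2 ∈ Finset.Icc 1 10 by decide),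
    ← InPiece.conj (show 1 ∈ Finset.Icc 1 10 by decide)] at H
  exact H

theorem InK.exists_inPiece {x y : ℝ} (h : InK x y) : ∃ j ∈ Finset.Icc 1 10, InPiece j x y := by
  rcases le_total 0 y with hy | hy
  · rcases h.upper_cases hy with H | H | H | H | H | H
    exacts [⟨3, by decide, H.2⟩, ⟨4, by decide, H.2.2.2⟩, ⟨5, by decide, H.2.2.2⟩,
      ⟨6, by decide, H.2.2⟩, ⟨2, by decide, H.2.2⟩, ⟨1, by decide, H.2.2⟩]
  · rcases h.lower_cases hy with H | H | H | H | H | H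
    exacts [⟨8, by decide, H.2⟩, ⟨9, by decide, H.2.2.2⟩, ⟨10, by decide, H.2.2.2⟩,
      ⟨6, by decide, H.2.2⟩, ⟨7, by decide, H.2.2⟩, ⟨1, by decide, H.2.2⟩]

/-- A horizontal strip is tiled by translates of `K`. -/
theorem exists_sub_inK {u y : ℝ} (h1 : -1 / 2 ≤ y) (h2 : y ≤ 1 / 2) :
    ∃ n : ℤ, InK (u - n) y ∧ u ≤ n + 1 / 7 ∧ n < u + 1 := by
  have a1 := Int.le_ceil u
  have a2 := Int.ceil_lt_add_one u
  have hy : y ^ 2 ≤ 1 / 4 := by nlinarith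
  -- The offset from ⌈u⌉ is nonpositive, so the disc about 1 is avoided for free. If the offset
  -- leaves the unit disc, shifting by one turns that failure into avoidance of the disc about 1,
  -- and -6/7 ≥ -√3/2 keeps the new offset below 1/7.
  rcases le_total ((u - ⌈u⌉) ^ 2 + y ^ 2) 1 with h | h
  · refine ⟨⌈u⌉, ⟨?_, ?_, ?_, ?_⟩, by linarith, a2⟩ <;> simp only [quad]
    · linarith
    · nlinarith [sq_nonneg (u - ⌈u⌉), sq_nonneg y]
    · linarith
    · linarith
  · have hx : u - ⌈u⌉ ≤ -6 / 7 := by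
      by_contra! hc
      nlinarith
    refine ⟨⌈u⌉ - 1, ⟨?_, ?_, ?_, ?_⟩, by push_cast; linarith, by push_cast; linarith⟩ <;>
      simp only [quad] <;> push_cast
    · nlinarith
    · nlinarith
    · linarith
    · linarith

/-- The strict upper bound matters: a point with v = 1/2 gets m = 1, which keeps row 0 out of the
lists for S(K_2) and S(K_4). -/
theorem exists_row (v : ℝ) : ∃ m : ℤ, -1 / 2 ≤ v - m ∧ v - m < 1 / 2 :=
  ⟨⌊v + 1 / 2⌋, by linarith [Int.floor_le (v + 1 / 2)], by linarith [Int.lt_floor_add_one (v + 1 / 2)]⟩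

theorem mk_mem_block {n m n' m' : ℤ} {j : ℕ} {J : Finset ℕ} :
    ((⟨n, m⟩ : GaussianInt), j) ∈ block n' m' J ↔ (n = n' ∧ m = m') ∧ j ∈ J := by
  simp [block, Zsqrtd.ext_iff]

/-- The point `u + v i` lies in one of the translates listed for `S(Kᵢ)`. -/
def Covered (i : ℕ) (u v : ℝ) : Prop :=
  ∃ (n m : ℤ) (j : ℕ), ((⟨n, m⟩ : GaussianInt), j) ∈ upperTranslates i ∧ InPiece j (u - n) (v - m)

/-- The image of `K ∖ {0}` under `S`. -/
def InSK (u v : ℝ) : Prop :=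
  1 ≤ u ^ 2 + v ^ 2 ∧ -1 / 2 ≤ u ∧ 2 * v ≤ u ^ 2 + v ^ 2 ∧ -2 * v ≤ u ^ 2 + v ^ 2

/-- The images of `K₁ ∖ {0}, …, K₆ ∖ {0}` under `S`. -/
def InSUpper : ℕ → ℝ → ℝ → Prop
  | 1, u, v => InSK u v ∧ 2 * u ≤ u ^ 2 + v ^ 2 ∧ 0 ≤ u ∧ v ≤ 1 / 2 ∧ -1 / 2 ≤ v
  | 2, u, v => InSK u v ∧ 1 / 2 ≤ v ∧ 1 / 2 ≤ u ∧ 1 ≤ (u - 1) ^ 2 + (v - 1) ^ 2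
  | 3, u, v => InSK u v ∧ 0 ≤ v ∧ u ≤ 1 / 2
  | 4, u, v => InSK u v ∧ 2 * u ≤ u ^ 2 + v ^ 2 ∧ (u - 1) ^ 2 + (v - 1) ^ 2 ≤ 1
  | 5, u, v => InSK u v ∧ u ^ 2 + v ^ 2 ≤ 2 * u ∧ (u - 1) ^ 2 + (v - 1) ^ 2 ≤ 1
  | 6, u, v => InSK u v ∧ u ^ 2 + v ^ 2 ≤ 2 * u ∧ 1 ≤ (u - 1) ^ 2 + (v - 1) ^ 2 ∧
      1 ≤ (u - 1) ^ 2 + (v + 1) ^ 2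
  | _, _, _ => False

/-! ### Which pieces meet a part of K cut out by extra inequalities -/

theorem InK.of_neg_half_le {x y : ℝ} (h : InK x y) (hx : -1 / 2 ≤ x) :
    ∃ j ∈ ({1, 2, 3, 4, 7, 8, 9} : Finset ℕ), InPiece j x y := by
  rcases le_total 0 y with hy | hy
  · rcases h.upper_cases hy with H | H | H | H | H | H
    exacts [⟨3, by decide, H.2⟩, ⟨4, by decide, H.2.2.2⟩, by linarith [H.2.2.1], by linarith [H.2.1],
      ⟨2, by decide, H.2.2⟩, ⟨1, by decide, H.2.2⟩]
  · rcases h.lower_cases hy with H | H | H | H | H | H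
    exacts [⟨8, by decide, H.2⟩, ⟨9, by decide, H.2.2.2⟩, by linarith [H.2.2.1], by linarith [H.2.1],
      ⟨7, by decide, H.2.2⟩, ⟨1, by decide, H.2.2⟩]

theorem InK.of_neg_half_le_of_le {x y : ℝ} (h : InK x y) (hx : -1 / 2 ≤ x)
    (hi : -2 * y ≤ x ^ 2 + y ^ 2) :
    ∃ j ∈ ({1, 2, 3, 4} : Finset ℕ), InPiece j x y := by
  have hK := h
  have r1 := h.re_le
  obtain ⟨k1, k2, k3, k4⟩ := hK
  rcases le_total 0 y with hy | hy
  · rcases h.upper_cases hy with H | H | H | H | H | H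
    exacts [⟨3, by decide, H.2⟩, ⟨4, by decide, H.2.2.2⟩, by linarith [H.2.2.1], by linarith [H.2.1],
      ⟨2, by decide, H.2.2⟩, ⟨1, by decide, H.2.2⟩]
  · simp only [quad] at k1 k2 k3 k4
    -- Below the axis and outside the disc about -i, the point is in K_1 unless it also avoids the
    -- disc about -1. In that case it avoids all four discs and is the origin, against strictness.
    rcases lt_or_ge 0 (x ^ 2 + y ^ 2 + 2 * x) with hc | hc
    · obtain ⟨rfl, rfl⟩ := cusp_eq_zero hx (by linarith) (by linarith) (by linarith) (by linarith)
        (by linarith) (by linarith [sq_nonneg x, sq_nonneg y]) hi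
      simp at hc
    · refine ⟨1, by decide, h, ?_, ?_, ?_, ?_⟩ <;> simp only [quad] <;>
        linarith [sq_nonneg x, sq_nonneg y]

theorem InK.of_neg_two_mul_re_le {x y : ℝ} (h : InK x y) (hx : -2 * x ≤ x ^ 2 + y ^ 2) :
    ∃ j ∈ ({3, 8} : Finset ℕ), InPiece j x y := by
  have k2 := h.2.1
  have k4 := h.2.2.2
  rcases le_total 0 y with hy | hy
  · refine ⟨3, by decide, h, ?_, k4, k2, ?_⟩ <;> simp only [quad] <;> linarith
  · refine ⟨8, by decide, h.neg, ?_, h.neg.2.2.2, h.neg.2.1, ?_⟩ <;> simp only [quad] <;> linarith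

theorem InK.of_le_neg_half {x y : ℝ} (h : InK x y) (hx : x ≤ -1 / 2) :
    ∃ j ∈ ({5, 6, 10} : Finset ℕ), InPiece j x y := by
  rcases le_total 0 (quad (-1) (-2) 2 (-1) x y) with a | a
  · refine ⟨5, by decide, h, ?_, a⟩
    simp only [quad]; linarith
  rcases le_total 0 (quad (-1) (-2) 2 (-1) x (-y)) with b | b
  · refine ⟨10, by decide, h.neg, ?_, b⟩
    simp only [quad]; linarith
  refine ⟨6, by decide, h, ?_, ?_, ?_⟩ <;> simp only [quad] at * <;> linarith

theorem InK.of_le_neg_half_of_le {x y : ℝ} (h : InK x y) (hx : x ≤ -1 / 2)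
    (hi : 1 ≤ (x + 1) ^ 2 + (y + 1) ^ 2) :
    ∃ j ∈ ({5, 6} : Finset ℕ), InPiece j x y := by
  rcases le_total 0 (quad (-1) (-2) 2 (-1) x y) with a | a
  · refine ⟨5, by decide, h, ?_, a⟩
    simp only [quad]; linarith
  refine ⟨6, by decide, h, ?_, ?_, ?_⟩ <;> simp only [quad] at * <;> linarith

theorem InK.of_one_le {x y : ℝ} (h : InK x y) (hi : 1 ≤ (x + 1) ^ 2 + (y + 1) ^ 2) :
    ∃ j ∈ Finset.Icc 1 8, InPiece j x y := by
  rcases le_total 0 y with hy | hy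
  · rcases h.upper_cases hy with H | H | H | H | H | H
    exacts [⟨3, by decide, H.2⟩, ⟨4, by decide, H.2.2.2⟩, ⟨5, by decide, H.2.2.2⟩,
      ⟨6, by decide, H.2.2⟩, ⟨2, by decide, H.2.2⟩, ⟨1, by decide, H.2.2⟩]
  · have hq : 0 ≤ quad 1 2 2 1 x y := by simp only [quad]; linarith
    rcases h.lower_cases hy with H | H | H | H | H | H
    exacts [⟨8, by decide, H.2⟩, by linarith [H.2.1], by linarith [H.2.1],
      ⟨6, by decide, H.2.2⟩, ⟨7, by decide, H.2.2⟩, ⟨1, by decide, H.2.2⟩]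

theorem InK.of_one_le_of_le {x y : ℝ} (h : InK x y) (hi : 1 ≤ (x + 1) ^ 2 + (y + 1) ^ 2)
    (hx : x ^ 2 + y ^ 2 ≤ -2 * x) :
    ∃ j ∈ ({1, 2, 4, 5, 6, 7} : Finset ℕ), InPiece j x y := by
  have hx' : quad 1 2 0 0 x y ≤ 0 := by simp only [quad]; linarith
  rcases le_total 0 y with hy | hy
  · rcases h.upper_cases hy with H | H | H | H | H | H
    exacts [by linarith [H.1], ⟨4, by decide, H.2.2.2⟩, ⟨5, by decide, H.2.2.2⟩,
      ⟨6, by decide, H.2.2⟩, ⟨2, by decide, H.2.2⟩, ⟨1, by decide, H.2.2⟩]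
  · have hq : 0 ≤ quad 1 2 2 1 x y := by simp only [quad]; linarith
    rcases h.lower_cases hy with H | H | H | H | H | H
    exacts [by linarith [H.1], by linarith [H.2.1], by linarith [H.2.1],
      ⟨6, by decide, H.2.2⟩, ⟨7, by decide, H.2.2⟩, ⟨1, by decide, H.2.2⟩]

theorem InK.of_one_le_of_one_le {x y : ℝ} (h : InK x y) (hi : 1 ≤ (x + 1) ^ 2 + (y + 1) ^ 2)
    (hi' : 1 ≤ (x + 1) ^ 2 + (y - 1) ^ 2) (hx : x ^ 2 + y ^ 2 ≤ -2 * x) :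
    ∃ j ∈ ({1, 2, 6, 7} : Finset ℕ), InPiece j x y := by
  have hx' : quad 1 2 0 0 x y ≤ 0 := by simp only [quad]; linarith
  have hq' : 0 ≤ quad 1 2 (-2) 1 x y := by simp only [quad]; linarith
  rcases le_total 0 y with hy | hy
  · rcases h.upper_cases hy with H | H | H | H | H | H
    exacts [by linarith [H.1], by linarith [H.2.1], by linarith [H.2.1],
      ⟨6, by decide, H.2.2⟩, ⟨2, by decide, H.2.2⟩, ⟨1, by decide, H.2.2⟩]
  · have hq : 0 ≤ quad 1 2 2 1 x y := by simp only [quad]; linarith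
    rcases h.lower_cases hy with H | H | H | H | H | H
    exacts [by linarith [H.1], by linarith [H.2.1], by linarith [H.2.1],
      ⟨6, by decide, H.2.2⟩, ⟨7, by decide, H.2.2⟩, ⟨1, by decide, H.2.2⟩]

theorem InK.of_im_nonpos {x y : ℝ} (h : InK x y) (hy : y ≤ 0)
    (hi : 1 ≤ (x + 1) ^ 2 + (y + 1) ^ 2) (hi' : x ^ 2 + y ^ 2 ≤ -2 * y) :
    ∃ j ∈ ({7, 8} : Finset ℕ), InPiece j x y := by
  rcases le_total (-2 * x) (x ^ 2 + y ^ 2) with a | a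
  · refine ⟨8, by decide, h.neg, ?_, h.neg.2.2.2, h.neg.2.1, ?_⟩ <;> simp only [quad] <;> linarith
  · refine ⟨7, by decide, h.neg, ?_, ?_, ?_⟩ <;> simp only [quad] <;> linarith

theorem InK.of_le_one {x y : ℝ} (h : InK x y) (hi : (x + 1) ^ 2 + (y - 1) ^ 2 ≤ 1) :
    ∃ j ∈ ({4, 5} : Finset ℕ), InPiece j x y := by
  rcases le_total (-1 / 2) x with a | a
  · refine ⟨4, by decide, h, ?_, ?_⟩ <;> simp only [quad] <;> linarith
  · refine ⟨5, by decide, h, ?_, ?_⟩ <;> simp only [quad] <;> linarith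

theorem InK.of_le_one' {x y : ℝ} (h : InK x y) (hi : (x + 1) ^ 2 + (y + 1) ^ 2 ≤ 1) :
    ∃ j ∈ ({9, 10} : Finset ℕ), InPiece j x y := by
  rcases le_total (-1 / 2) x with a | a
  · refine ⟨9, by decide, h.neg, ?_, ?_⟩ <;> simp only [quad] <;> linarith
  · refine ⟨10, by decide, h.neg, ?_, ?_⟩ <;> simp only [quad] <;> linarith

/-! ### Points of S(K_i) lie in the listed translates -/

theorem Covered.of_exists {i : ℕ} {u v : ℝ} (n m : ℤ) {J : Finset ℕ}
    (hJ : block n m J ⊆ upperTranslates i) (h : ∃ j ∈ J, InPiece j (u - n) (v - m)) :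
    Covered i u v := by
  obtain ⟨j, hj, hP⟩ := h
  exact ⟨n, m, j, hJ ⟨rfl, hj⟩, hP⟩

theorem block_subset_one {n : ℤ} (hn : 3 ≤ n) :
    block n 0 (Finset.Icc 1 10) ⊆ upperTranslates 1 := by
  intro p hp
  simp only [upperTranslates, mem_union, mem_iUnion]
  exact Or.inr ⟨n, hn, hp⟩

theorem covered_one {u v : ℝ} (h : InSUpper 1 u v) : Covered 1 u v := by
  obtain ⟨⟨h1, h2, h3, h4⟩, h5, h6, h7, h8⟩ := h
  obtain ⟨n, hn, hu, hu'⟩ := exists_sub_inK (u := u) h8 h7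
  have hv : v ^ 2 ≤ 1 / 4 := by nlinarith
  -- From (u - 1)² ≥ 3/4 and u² ≥ 3/4 one gets u ≥ 1 + √3/2 ≈ 1.866; 9/5 is large enough to rule out
  -- n = 1.
  have hu1 : 9 / 5 ≤ u := by
    by_contra! hc
    nlinarith
  have hn2 : 2 ≤ n := by
    have : (1 : ℝ) < n := by linarith
    exact_mod_cast this
  have hn' : InK (u - n) (v - (0 : ℤ)) := by simpa using hn
  rcases eq_or_lt_of_le hn2 with rfl | hn3
  · refine .of_exists 2 0 (J := {3, 8}) ?_ (hn'.of_neg_two_mul_re_le ?_)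
    · exact subset_union_left
    · push_cast; linarith
  · exact .of_exists n 0 (block_subset_one hn3) hn'.exists_inPiece

theorem covered_two {u v : ℝ} (h : InSUpper 2 u v) : Covered 2 u v := by
  obtain ⟨⟨h1, h2, h3, h4⟩, h5, h6, h7⟩ := h
  obtain ⟨m, hm, hm'⟩ := exists_row v
  obtain ⟨n, hn, hu, hu'⟩ := exists_sub_inK (u := u) hm hm'.le
  have hv : (v - m) ^ 2 ≤ 1 / 4 := by nlinarith
  have hn1 : 1 ≤ n := by
    have : (0 : ℝ) < n := by linarith
    exact_mod_cast this
  have hm1 : 1 ≤ m := by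
    have : (0 : ℝ) < m := by linarith
    exact_mod_cast this
  have hn1 : n = 1 ∨ n = 2 ∨ 3 ≤ n := by lia
  have hm1 : m = 1 ∨ m = 2 ∨ 3 ≤ m := by lia
  rcases hn1 with rfl | rfl | hn3
  · have hx : -1 / 2 ≤ u - (1 : ℤ) := by push_cast; linarith
    rcases hm1 with rfl | rfl | hm3
    -- The translate by 1 + i cannot occur: offsets in [-1/2, 1/7] × [-1/2, 1/2] are closer than 1
    -- to 1 + i.
    · push_cast at *
      nlinarith
    · refine .of_exists 1 2 (J := {1, 2, 3, 4}) ?_ (hn.of_neg_half_le_of_le hx ?_)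
      · intro p hp; simp only [upperTranslates, mem_union]; tauto
      · push_cast; linarith
    · refine .of_exists 1 m (J := {1, 2, 3, 4, 7, 8, 9}) ?_ (hn.of_neg_half_le hx)
      intro p hp; simp only [upperTranslates, mem_union, mem_iUnion]
      exact Or.inl <| Or.inl <| Or.inr ⟨m, hm3, hp⟩
  · rcases hm1 with rfl | rfl | hm3
    · refine .of_exists 2 1 (J := {3, 8}) ?_ (hn.of_neg_two_mul_re_le ?_)
      · intro p hp; simp only [upperTranslates, mem_union]; tauto
      · push_cast; linarith
    · refine .of_exists 2 2 (J := Finset.Icc 1 8) ?_ (hn.of_one_le ?_)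
      · intro p hp; simp only [upperTranslates, mem_union]; tauto
      · push_cast; linarith
    · refine .of_exists 2 m (J := Finset.Icc 1 10) ?_ hn.exists_inPiece
      intro p hp; simp only [upperTranslates, mem_union, mem_iUnion]
      exact Or.inl <| Or.inr ⟨m, hm3, hp⟩
  · refine .of_exists n m (J := Finset.Icc 1 10) ?_ hn.exists_inPiece
    intro p hp; simp only [upperTranslates, mem_union, mem_iUnion]
    exact Or.inr ⟨n, hn3, m, by lia, hp⟩

theorem covered_three {u v : ℝ} (h : InSUpper 3 u v) : Covered 3 u v := by
  obtain ⟨⟨h1, h2, h3, h4⟩, h5, h6⟩ := h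
  obtain ⟨m, hm, hm'⟩ := exists_row v
  obtain ⟨n, hn, hu, hu'⟩ := exists_sub_inK (u := u) hm hm'.le
  have hsq : u ^ 2 ≤ 1 / 4 := by nlinarith
  have hv : 9 / 5 ≤ v := by
    by_contra! hc
    nlinarith
  have hm1 : 2 ≤ m := by
    have : (1 : ℝ) < m := by linarith
    exact_mod_cast this
  have hn0 : 0 ≤ n := by
    have : (-1 : ℝ) < n := by linarith
    exact_mod_cast this
  have hn1 : n < 2 := by
    have : (n : ℝ) < 2 := by linarith
    exact_mod_cast this
  have hn1 : n = 0 ∨ n = 1 := by lia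
  rcases hn1 with rfl | rfl
  · have hx : -1 / 2 ≤ u - (0 : ℤ) := by push_cast; linarith
    rcases eq_or_lt_of_le hm1 with rfl | hm3
    · refine .of_exists 0 2 (J := {1, 2, 3, 4}) ?_ (hn.of_neg_half_le_of_le hx ?_)
      · intro p hp; simp only [upperTranslates, mem_union]; tauto
      · push_cast; linarith
    · refine .of_exists 0 m (J := {1, 2, 3, 4, 7, 8, 9}) ?_ (hn.of_neg_half_le hx)
      intro p hp; simp only [upperTranslates, mem_union, mem_iUnion]
      exact Or.inl <| Or.inr ⟨m, hm3, hp⟩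
  · have hx : u - (1 : ℤ) ≤ -1 / 2 := by push_cast; linarith
    rcases eq_or_lt_of_le hm1 with rfl | hm3
    · refine .of_exists 1 2 (J := {5, 6}) ?_ (hn.of_le_neg_half_of_le hx ?_)
      · intro p hp; simp only [upperTranslates, mem_union]; tauto
      · push_cast; linarith
    · refine .of_exists 1 m (J := {5, 6, 10}) ?_ (hn.of_le_neg_half hx)
      intro p hp; simp only [upperTranslates, mem_union, mem_iUnion]
      exact Or.inr ⟨m, hm3, hp⟩

theorem covered_four {u v : ℝ} (h : InSUpper 4 u v) : Covered 4 u v := by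
  obtain ⟨⟨h1, h2, h3, h4⟩, h5, h6⟩ := h
  obtain ⟨m, hm, hm'⟩ := exists_row v
  obtain ⟨n, hn, hu, hu'⟩ := exists_sub_inK (u := u) hm hm'.le
  have hu2 : u ≤ 2 := by nlinarith [sq_nonneg (v - 1)]
  have hv2 : v ≤ 2 := by nlinarith [sq_nonneg (u - 1)]
  have hn1 : 1 ≤ n := by
    have : (0 : ℝ) < n := by linarith
    exact_mod_cast this
  have hn2 : n < 3 := by
    have : (n : ℝ) < 3 := by linarith
    exact_mod_cast this
  have hm1 : 1 ≤ m := by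
    have : (0 : ℝ) < m := by linarith
    exact_mod_cast this
  have hm2 : m < 3 := by
    have : (m : ℝ) < 3 := by linarith
    exact_mod_cast this
  obtain rfl | rfl : n = 1 ∨ n = 2 := by lia
  · have hx : -1 / 2 ≤ u - (1 : ℤ) := by push_cast; linarith
    obtain rfl | rfl : m = 1 ∨ m = 2 := by lia
    · refine .of_exists 1 1 (J := {3}) ?_ ⟨3, by decide, ?_⟩
      · intro p hp; simp only [upperTranslates, mem_union]; tauto
      have hK := hn
      have r1 := hK.re_le
      obtain ⟨k1, k2, k3, k4⟩ := hK
      simp only [quad] at k1 k2 k3 k4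
      rcases le_total 0 (v - (1 : ℤ)) with hy | hy
      · refine ⟨hn, ?_, ?_, ?_, ?_⟩ <;> push_cast at * <;> simp only [quad] <;> linarith
      -- Relative to 1 + i, the excluded discs about 1 and i become those about -i and -1, so at or
      -- below the axis only the corner w = 1 + i survives, and it belongs to 1 + i + K_3.
      · obtain ⟨e1, e2⟩ := cusp_eq_zero (y := v - (1 : ℤ)) hx (by linarith) hm hm'.le
          (by linarith) (by push_cast; linarith)
          (by linarith [sq_nonneg (u - (1 : ℤ)), sq_nonneg (v - (1 : ℤ))]) (by push_cast; linarith)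
        rw [e1, e2] at hn ⊢
        refine ⟨hn, ?_, ?_, ?_, ?_⟩ <;> norm_num [quad]
    · refine .of_exists 1 2 (J := {7, 8}) ?_ (hn.of_im_nonpos ?_ ?_ ?_)
      · intro p hp; simp only [upperTranslates, mem_union]; tauto
      all_goals push_cast; linarith
  · obtain rfl | rfl : m = 1 ∨ m = 2 := by lia
    · refine .of_exists 2 1 (J := {1, 2, 4, 5, 6, 7}) ?_ (hn.of_one_le_of_le ?_ ?_)
      · intro p hp; simp only [upperTranslates, mem_union]; tauto
      all_goals push_cast; linarith
    · refine .of_exists 2 2 (J := {9, 10}) ?_ (hn.of_le_one' ?_)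
      · intro p hp; simp only [upperTranslates, mem_union]; tauto
      push_cast; linarith

theorem covered_five {u v : ℝ} (h : InSUpper 5 u v) : Covered 5 u v := by
  obtain ⟨⟨h1, h2, h3, h4⟩, h5, h6⟩ := h
  obtain ⟨m, hm, hm'⟩ := exists_row v
  obtain ⟨n, hn, hu, hu'⟩ := exists_sub_inK (u := u) hm hm'.le
  have hu2 : u ≤ 2 := by nlinarith [sq_nonneg (v - 1)]
  have hv0 : 0 ≤ v := by nlinarith [sq_nonneg (u - 1)]
  have hv2 : v ≤ 1 := by nlinarith [sq_nonneg (u - 1)]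
  have hn1 : 1 ≤ n := by
    have : (0 : ℝ) < n := by linarith
    exact_mod_cast this
  have hn2 : n < 3 := by
    have : (n : ℝ) < 3 := by linarith
    exact_mod_cast this
  have hm1 : 0 ≤ m := by
    have : (-1 : ℝ) < m := by linarith
    exact_mod_cast this
  have hm2 : m < 2 := by
    have : (m : ℝ) < 2 := by linarith
    exact_mod_cast this
  obtain rfl | rfl : n = 1 ∨ n = 2 := by lia
  · have hK := hn
    obtain ⟨k1, k2, k3, k4⟩ := hK
    simp only [quad] at k1 k2 k3 k4
    obtain rfl | rfl : m = 0 ∨ m = 1 := by lia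
    · refine .of_exists 1 0 (J := {3}) ?_ ⟨3, by decide, hn, ?_, ?_, ?_, ?_⟩
      · intro p hp; simp only [upperTranslates, mem_union]; tauto
      all_goals (push_cast at *; simp only [quad]; linarith)
    · refine .of_exists 1 1 (J := {8}) ?_ ⟨8, by decide, hn.neg, ?_, ?_, ?_, ?_⟩
      · intro p hp; simp only [upperTranslates, mem_union]; tauto
      all_goals (push_cast at *; simp only [quad]; linarith)
  · obtain rfl | rfl : m = 0 ∨ m = 1 := by lia
    · refine .of_exists 2 0 (J := {4, 5}) ?_ (hn.of_le_one ?_)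
      · intro p hp; simp only [upperTranslates, mem_union]; tauto
      push_cast; linarith
    · refine .of_exists 2 1 (J := {9, 10}) ?_ (hn.of_le_one' ?_)
      · intro p hp; simp only [upperTranslates, mem_union]; tauto
      push_cast; linarith

theorem covered_six {u v : ℝ} (h : InSUpper 6 u v) : Covered 6 u v := by
  obtain ⟨⟨h1, h2, h3, h4⟩, h5, h6, h7⟩ := h
  have hu2 : u ≤ 2 := by nlinarith [sq_nonneg v]
  -- Subtracting |w - 1| ≤ 1 from |w - 1 ± i| ≥ 1 leaves |v| ≤ 1/2, so only row 0 is involved.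
  have b1 : -1 / 2 ≤ v - (0 : ℤ) := by push_cast; linarith
  have b2 : v - (0 : ℤ) ≤ 1 / 2 := by push_cast; linarith
  obtain ⟨n, hn, hu, hu'⟩ := exists_sub_inK (u := u) b1 b2
  have hn1 : 1 ≤ n := by
    have : (0 : ℝ) < n := by linarith
    exact_mod_cast this
  have hn2 : n < 3 := by
    have : (n : ℝ) < 3 := by linarith
    exact_mod_cast this
  have hK : InK (u - (2 : ℤ)) (v - (0 : ℤ)) := by
    obtain rfl | rfl : n = 1 ∨ n = 2 := by lia
    -- For n = 1 the four discs force w = 1, which is also 2 + (-1) with -1 in K.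
    · have hx : -1 / 2 ≤ u - (1 : ℤ) := by push_cast; linarith
      have r1 := hn.re_le
      obtain ⟨k1, k2, k3, k4⟩ := hn
      simp only [quad] at k1 k2 k3 k4
      obtain ⟨e1, e2⟩ := cusp_eq_zero hx (by linarith) b1 b2 (by linarith)
          (by push_cast; linarith) (by push_cast; linarith) (by push_cast; linarith)
      have e3 : u - (2 : ℤ) = -1 := by push_cast at *; linarith
      rw [e2, e3]
      norm_num [InK, quad]
    · exact hn
  refine .of_exists 2 0 (J := {1, 2, 6, 7}) subset_rfl (hK.of_one_le_of_one_le ?_ ?_ ?_) <;>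
    push_cast <;> linarith

/-! ### Listed translates lie in S(K_i) -/

/-- Linear consequences of the inequalities that define the pieces. -/
def Bounds : ℕ → ℝ → ℝ → Prop
  | 1, x, y => -1 / 2 ≤ x ∧ x ≤ 0 ∧ 2 * y ≤ x ^ 2 + y ^ 2 ∧ -2 * y ≤ x ^ 2 + y ^ 2 ∧
      x ^ 2 + y ^ 2 ≤ -2 * x
  | 2, x, y => -1 / 2 ≤ x ∧ x ≤ 0 ∧ 0 ≤ y ∧ x ^ 2 + y ^ 2 ≤ 2 * y ∧ x ^ 2 + y ^ 2 ≤ -2 * x ∧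
      1 ≤ (x + 1) ^ 2 + (y - 1) ^ 2
  | 3, x, y => -1 / 2 ≤ x ∧ 0 ≤ y ∧ -2 * x ≤ x ^ 2 + y ^ 2 ∧ x ^ 2 + y ^ 2 ≤ 2 * y
  | 4, x, y => -1 / 2 ≤ x ∧ 0 ≤ y ∧ (x + 1) ^ 2 + (y - 1) ^ 2 ≤ 1 ∧ x ^ 2 + y ^ 2 ≤ -2 * x ∧
      x ^ 2 + y ^ 2 ≤ 2 * y
  | 5, x, y => x ≤ -1 / 2 ∧ 0 ≤ y ∧ (x + 1) ^ 2 + (y - 1) ^ 2 ≤ 1 ∧ x ^ 2 + y ^ 2 ≤ -2 * x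
  | 6, x, y => x ≤ -1 / 2 ∧ 1 ≤ (x + 1) ^ 2 + (y - 1) ^ 2 ∧ 1 ≤ (x + 1) ^ 2 + (y + 1) ^ 2 ∧
      x ^ 2 + y ^ 2 ≤ -2 * x
  | 7, x, y => -1 / 2 ≤ x ∧ x ≤ 0 ∧ y ≤ 0 ∧ x ^ 2 + y ^ 2 ≤ -2 * y ∧ x ^ 2 + y ^ 2 ≤ -2 * x ∧
      1 ≤ (x + 1) ^ 2 + (y + 1) ^ 2
  | 8, x, y => -1 / 2 ≤ x ∧ y ≤ 0 ∧ -2 * x ≤ x ^ 2 + y ^ 2 ∧ x ^ 2 + y ^ 2 ≤ -2 * y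
  | 9, x, y => -1 / 2 ≤ x ∧ y ≤ 0 ∧ (x + 1) ^ 2 + (y + 1) ^ 2 ≤ 1 ∧ x ^ 2 + y ^ 2 ≤ -2 * x ∧
      x ^ 2 + y ^ 2 ≤ -2 * y
  | 10, x, y => x ≤ -1 / 2 ∧ y ≤ 0 ∧ (x + 1) ^ 2 + (y + 1) ^ 2 ≤ 1 ∧ x ^ 2 + y ^ 2 ≤ -2 * x
  | _, _, _ => False

/-- The linear consequences of the inequalities that define `K`. -/
theorem InK.bounds {x y : ℝ} (h : InK x y) : x ^ 2 + y ^ 2 ≤ 1 ∧ 2 * x ≤ x ^ 2 + y ^ 2 ∧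
    -1 / 2 ≤ y ∧ y ≤ 1 / 2 ∧ -1 ≤ x ∧ x ≤ 1 / 7 := by
  have h5 := h.re_le
  have h6 := h.neg_one_le_re
  obtain ⟨h1, h2, h3, h4⟩ := h
  simp only [quad] at *
  refine ⟨?_, ?_, ?_, ?_, h6, h5⟩ <;> linarith

/-- Supplies the nonlinear inequality missing for K_1 and K_3: in the relevant range, avoiding the
discs about ±i forces membership in the disc about -1, and avoiding those about ±1 forces membership
in the disc about i. Indeed t > s would give s² + t² < 2t² ≤ t. -/
theorem sq_add_sq_le_two_mul {s t : ℝ} (hs : 0 ≤ s) (hs' : s ≤ 1) (ht : 0 ≤ t) (ht' : t ≤ 1 / 2)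
    (h : 2 * t ≤ s ^ 2 + t ^ 2) : s ^ 2 + t ^ 2 ≤ 2 * s := by
  have hts : t ≤ s := by
    by_contra! hc
    nlinarith
  nlinarith

theorem InUpper.bounds {j : ℕ} {x y : ℝ} (h : InUpper j x y) : Bounds j x y := by
  have hx := sq_nonneg x
  have hx1 := sq_nonneg (x + 1)
  have hy := sq_nonneg y
  unfold InUpper at h
  split at h
  · obtain ⟨hK, h1, h2, h3, h4⟩ := h
    obtain ⟨k1, k2, k3, k4, k5, k6⟩ := hK.bounds
    simp only [quad] at *
    refine ⟨by linarith, by linarith, by linarith, by linarith, ?_⟩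
    have hq := sq_add_sq_le_two_mul (s := -x) (t := |y|) (by linarith) (by linarith)
      (abs_nonneg y) (abs_le.2 ⟨by linarith, k4⟩)
      (by rw [sq_abs]; rcases abs_cases y with h | h <;> linarith)
    rw [sq_abs] at hq
    linarith
  · obtain ⟨hK, h1, h2, h3⟩ := h
    obtain ⟨k1, k2, k3, k4, k5, k6⟩ := hK.bounds
    simp only [quad] at *
    refine ⟨?_, ?_, ?_, ?_, ?_, ?_⟩ <;> linarith
  · obtain ⟨hK, h1, h2, h3, h4⟩ := h
    obtain ⟨k1, k2, k3, k4, k5, k6⟩ := hK.bounds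
    simp only [quad] at *
    refine ⟨by linarith, by linarith, by linarith, ?_⟩
    have hq := sq_add_sq_le_two_mul (s := y) (t := |x|) (by linarith) (by linarith)
      (abs_nonneg x) (abs_le.2 ⟨by linarith, by linarith⟩)
      (by rw [sq_abs]; rcases abs_cases x with h | h <;> linarith)
    rw [sq_abs] at hq
    linarith
  · obtain ⟨hK, h1, h2⟩ := h
    obtain ⟨k1, k2, k3, k4, k5, k6⟩ := hK.bounds
    simp only [quad] at *
    refine ⟨?_, ?_, ?_, ?_, ?_⟩ <;> linarith
  · obtain ⟨hK, h1, h2⟩ := h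
    obtain ⟨k1, k2, k3, k4, k5, k6⟩ := hK.bounds
    simp only [quad] at *
    refine ⟨?_, ?_, ?_, ?_⟩ <;> linarith
  · obtain ⟨hK, h1, h2, h3⟩ := h
    obtain ⟨k1, k2, k3, k4, k5, k6⟩ := hK.bounds
    simp only [quad] at *
    refine ⟨?_, ?_, ?_, ?_⟩ <;> linarith
  · exact h.elim

theorem InPiece.bounds {j : ℕ} (hj : j ∈ Finset.Icc 1 10) {x y : ℝ} (h : InPiece j x y) :
    Bounds j x y := by
  obtain ⟨a, b⟩ := Finset.mem_Icc.1 hj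
  unfold InPiece at h
  split at h
  · exact h.bounds
  · have := h.bounds
    interval_cases j
    all_goals
      simp only [Nat.reduceSub, Bounds] at this ⊢
      casesm* _ ∧ _
      repeat' apply And.intro
      all_goals linarith

theorem mem_Icc_of_mem_upperTranslates {i j : ℕ} {a : GaussianInt}
    (h : (a, j) ∈ upperTranslates i) : j ∈ Finset.Icc 1 10 := by
  unfold upperTranslates at h
  split at h <;>
    simp only [mem_union, mem_iUnion, block, mem_ofPred_eq, Finset.mem_insert, Finset.mem_singleton,
      Finset.mem_Icc, mem_empty_iff_false] at h ⊢ <;>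
    grind

/-- For a fixed translate the target inequalities are affine in x, y, x², y², so `Bounds` yields
them linearly. The infinite family n ≥ 3 is far enough out for the bounds of K alone. The other
indices follow the same pattern. -/
theorem inSUpper_one {n m : ℤ} {j : ℕ} {x y : ℝ}
    (hj : ((⟨n, m⟩ : GaussianInt), j) ∈ upperTranslates 1) (hP : InPiece j x y) :
    InSUpper 1 (n + x) (m + y) := by
  obtain ⟨k1, k2, k3, k4, k5, k6⟩ := hP.inK.bounds
  have hb := hP.bounds (mem_Icc_of_mem_upperTranslates hj)
  have hx := sq_nonneg x
  have hx1 := sq_nonneg (x + 1)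
  have hy := sq_nonneg y
  simp only [upperTranslates, mem_union, mem_iUnion, mk_mem_block] at hj
  rcases hj with ⟨⟨rfl, rfl⟩, hj⟩ | ⟨n', hn, ⟨rfl, rfl⟩, hj⟩
  · simp only [Finset.mem_insert, Finset.mem_singleton] at hj
    rcases hj with rfl | rfl <;>
    · obtain ⟨h1, h2, h3, h4⟩ := hb
      push_cast
      refine ⟨⟨?_, ?_, ?_, ?_⟩, ?_, ?_, ?_, ?_⟩ <;> linarith
  · have hn : (3 : ℝ) ≤ n := by exact_mod_cast hn
    have hu : 2 ≤ n + x := by linarith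
    push_cast
    refine ⟨⟨?_, ?_, ?_, ?_⟩, ?_, ?_, ?_, ?_⟩ <;> nlinarith

/-- The disc inequality reads u² + v² ≥ 2u + 2v - 1, which dominates 2v and 1 when u, v ≥ 1/2. -/
theorem inSUpper_two_of_le {u v : ℝ} (hu : 1 / 2 ≤ u) (hv : 1 / 2 ≤ v)
    (h : 1 ≤ (u - 1) ^ 2 + (v - 1) ^ 2) : InSUpper 2 u v := by
  refine ⟨⟨?_, ?_, ?_, ?_⟩, hv, hu, h⟩ <;> linarith

theorem inSUpper_two {n m : ℤ} {j : ℕ} {x y : ℝ}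
    (hj : ((⟨n, m⟩ : GaussianInt), j) ∈ upperTranslates 2) (hP : InPiece j x y) :
    InSUpper 2 (n + x) (m + y) := by
  obtain ⟨k1, k2, k3, k4, k5, k6⟩ := hP.inK.bounds
  have hb := hP.bounds (mem_Icc_of_mem_upperTranslates hj)
  have hx := sq_nonneg x
  have hx1 := sq_nonneg (x + 1)
  have hy := sq_nonneg y
  simp only [upperTranslates, mem_union, mem_iUnion, mk_mem_block] at hj
  rcases hj with (((((⟨⟨rfl, rfl⟩, hj⟩ | ⟨⟨rfl, rfl⟩, hj⟩) | ⟨⟨rfl, rfl⟩, hj⟩) |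
    ⟨m', hm, ⟨rfl, rfl⟩, hj⟩) | ⟨m', hm, ⟨rfl, rfl⟩, hj⟩) | ⟨n', hn, m', hm, ⟨rfl, rfl⟩, hj⟩)
  · simp only [Finset.mem_insert, Finset.mem_singleton] at hj
    rcases hj with rfl | rfl <;>
    · obtain ⟨h1, h2, h3, h4⟩ := hb
      push_cast
      apply inSUpper_two_of_le <;> linarith
  · simp only [Finset.mem_insert, Finset.mem_singleton] at hj
    rcases hj with rfl | rfl | rfl | rfl <;>
    · simp only [Bounds] at hb
      casesm* _ ∧ _
      push_cast
      apply inSUpper_two_of_le <;> linarith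
  · obtain ⟨a, b⟩ := Finset.mem_Icc.1 hj
    interval_cases j <;>
    · simp only [Bounds] at hb
      casesm* _ ∧ _
      push_cast
      apply inSUpper_two_of_le <;> linarith
  · have hm : (3 : ℝ) ≤ m := by exact_mod_cast hm
    have hu : -1 / 2 ≤ x := by
      simp only [Finset.mem_insert, Finset.mem_singleton] at hj
      rcases hj with rfl | rfl | rfl | rfl | rfl | rfl | rfl <;> exact hb.1
    push_cast
    apply inSUpper_two_of_le
    · linarith
    · linarith
    · nlinarith [sq_nonneg (1 + x - 1)]
  · have hm : (3 : ℝ) ≤ m := by exact_mod_cast hm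
    push_cast
    apply inSUpper_two_of_le
    · linarith
    · linarith
    · nlinarith [sq_nonneg (2 + x - 1)]
  · have hm : (1 : ℝ) ≤ m := by exact_mod_cast hm
    have hn : (3 : ℝ) ≤ n := by exact_mod_cast hn
    apply inSUpper_two_of_le
    · linarith
    · linarith
    · nlinarith [sq_nonneg (m + y - 1)]

theorem inSUpper_three_of_le {u v : ℝ} (hu : -1 / 2 ≤ u) (hu' : u ≤ 1 / 2) (hv : 1 / 2 ≤ v)
    (h : 1 ≤ u ^ 2 + (v - 1) ^ 2) : InSUpper 3 u v := by
  refine ⟨⟨?_, ?_, ?_, ?_⟩, ?_, hu'⟩ <;> linarith [sq_nonneg u, sq_nonneg v]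

theorem inSUpper_three {n m : ℤ} {j : ℕ} {x y : ℝ}
    (hj : ((⟨n, m⟩ : GaussianInt), j) ∈ upperTranslates 3) (hP : InPiece j x y) :
    InSUpper 3 (n + x) (m + y) := by
  obtain ⟨k1, k2, k3, k4, k5, k6⟩ := hP.inK.bounds
  have hb := hP.bounds (mem_Icc_of_mem_upperTranslates hj)
  have hx := sq_nonneg x
  have hx1 := sq_nonneg (x + 1)
  have hy := sq_nonneg y
  simp only [upperTranslates, mem_union, mem_iUnion, mk_mem_block, Finset.mem_insert,
    Finset.mem_singleton] at hj
  rcases hj with (((⟨⟨rfl, rfl⟩, hj⟩ | ⟨⟨rfl, rfl⟩, hj⟩) |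
    ⟨m', hm, ⟨rfl, rfl⟩, hj⟩) | ⟨m', hm, ⟨rfl, rfl⟩, hj⟩)
  · rcases hj with rfl | rfl | rfl | rfl <;>
    · simp only [Bounds] at hb
      casesm* _ ∧ _
      push_cast
      apply inSUpper_three_of_le <;> linarith
  · rcases hj with rfl | rfl <;>
    · simp only [Bounds] at hb
      casesm* _ ∧ _
      push_cast
      apply inSUpper_three_of_le <;> linarith
  · have hm : (3 : ℝ) ≤ m := by exact_mod_cast hm
    have hu : -1 / 2 ≤ x := by
      rcases hj with rfl | rfl | rfl | rfl | rfl | rfl | rfl <;> exact hb.1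
    push_cast
    apply inSUpper_three_of_le
    · linarith
    · linarith
    · linarith
    · nlinarith [sq_nonneg (0 + x)]
  · have hm : (3 : ℝ) ≤ m := by exact_mod_cast hm
    have hu : x ≤ -1 / 2 := by
      rcases hj with rfl | rfl | rfl <;> exact hb.1
    push_cast
    apply inSUpper_three_of_le
    · linarith
    · linarith
    · linarith
    · nlinarith [sq_nonneg (1 + x)]

theorem inSUpper_four {n m : ℤ} {j : ℕ} {x y : ℝ}
    (hj : ((⟨n, m⟩ : GaussianInt), j) ∈ upperTranslates 4) (hP : InPiece j x y) :
    InSUpper 4 (n + x) (m + y) := by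
  obtain ⟨k1, k2, k3, k4, k5, k6⟩ := hP.inK.bounds
  have hb := hP.bounds (mem_Icc_of_mem_upperTranslates hj)
  have hx := sq_nonneg x
  have hx1 := sq_nonneg (x + 1)
  have hy := sq_nonneg y
  simp only [upperTranslates, mem_union, mk_mem_block, Finset.mem_insert,
    Finset.mem_singleton] at hj
  rcases hj with (((⟨⟨rfl, rfl⟩, rfl⟩ | ⟨⟨rfl, rfl⟩, rfl | rfl | rfl | rfl | rfl | rfl⟩) |
    ⟨⟨rfl, rfl⟩, rfl | rfl⟩) | ⟨⟨rfl, rfl⟩, rfl | rfl⟩) <;>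
  · simp only [Bounds] at hb
    casesm* _ ∧ _
    push_cast
    refine ⟨⟨?_, ?_, ?_, ?_⟩, ?_, ?_⟩ <;> linarith

theorem inSUpper_five {n m : ℤ} {j : ℕ} {x y : ℝ}
    (hj : ((⟨n, m⟩ : GaussianInt), j) ∈ upperTranslates 5) (hP : InPiece j x y) :
    InSUpper 5 (n + x) (m + y) := by
  obtain ⟨k1, k2, k3, k4, k5, k6⟩ := hP.inK.bounds
  have hb := hP.bounds (mem_Icc_of_mem_upperTranslates hj)
  have hx := sq_nonneg x
  have hx1 := sq_nonneg (x + 1)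
  have hy := sq_nonneg y
  simp only [upperTranslates, mem_union, mk_mem_block, Finset.mem_insert,
    Finset.mem_singleton] at hj
  rcases hj with (((⟨⟨rfl, rfl⟩, rfl⟩ | ⟨⟨rfl, rfl⟩, rfl | rfl⟩) |
    ⟨⟨rfl, rfl⟩, rfl⟩) | ⟨⟨rfl, rfl⟩, rfl | rfl⟩) <;>
  · simp only [Bounds] at hb
    casesm* _ ∧ _
    push_cast
    refine ⟨⟨?_, ?_, ?_, ?_⟩, ?_, ?_⟩ <;> linarith

theorem inSUpper_six {n m : ℤ} {j : ℕ} {x y : ℝ}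
    (hj : ((⟨n, m⟩ : GaussianInt), j) ∈ upperTranslates 6) (hP : InPiece j x y) :
    InSUpper 6 (n + x) (m + y) := by
  obtain ⟨k1, k2, k3, k4, k5, k6⟩ := hP.inK.bounds
  have hb := hP.bounds (mem_Icc_of_mem_upperTranslates hj)
  have hx := sq_nonneg x
  have hx1 := sq_nonneg (x + 1)
  have hy := sq_nonneg y
  simp only [upperTranslates, mk_mem_block, Finset.mem_insert, Finset.mem_singleton] at hj
  rcases hj with ⟨⟨rfl, rfl⟩, rfl | rfl | rfl | rfl⟩ <;>
  · simp only [Bounds] at hb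
    casesm* _ ∧ _
    push_cast
    refine ⟨⟨?_, ?_, ?_, ?_⟩, ?_, ?_, ?_⟩ <;> linarith

/-- The images of `K₁, …, K₆` under `S` are the unions of the listed translates. -/
theorem inSUpper_iff_covered {i : ℕ} (hi : i ∈ Finset.Icc 1 6) {u v : ℝ} :
    InSUpper i u v ↔ Covered i u v := by
  obtain ⟨a, b⟩ := Finset.mem_Icc.1 hi
  constructor
  · intro h
    interval_cases i
    exacts [covered_one h, covered_two h, covered_three h, covered_four h, covered_five h,
      covered_six h]
  · rintro ⟨n, m, j, hj, hP⟩
    have hu : u = n + (u - n) := by ring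
    have hv : v = m + (v - m) := by ring
    rw [hu, hv]
    interval_cases i
    exacts [inSUpper_one hj hP, inSUpper_two hj hP, inSUpper_three hj hP, inSUpper_four hj hP,
      inSUpper_five hj hP, inSUpper_six hj hP]

/-! ### The fundamental set of a shifted Hurwitz algorithm -/

theorem norm_le_one_iff (z : ℂ) : ‖z‖ ≤ 1 ↔ z.re ^ 2 + z.im ^ 2 ≤ 1 := by
  rw [← sq_le_one_iff₀ (norm_nonneg z), Complex.sq_norm, Complex.normSq_apply, sq, sq]

theorem one_le_norm_iff (z : ℂ) : 1 ≤ ‖z‖ ↔ 1 ≤ z.re ^ 2 + z.im ^ 2 := by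
  rw [← one_le_sq_iff₀ (norm_nonneg z), Complex.sq_norm, Complex.normSq_apply, sq z.re, sq z.im]

theorem norm_le_norm_iff (z w : ℂ) :
    ‖z‖ ≤ ‖w‖ ↔ z.re ^ 2 + z.im ^ 2 ≤ w.re ^ 2 + w.im ^ 2 := by
  rw [← sq_le_sq₀ (norm_nonneg z) (norm_nonneg w), Complex.sq_norm, Complex.sq_norm,
    Complex.normSq_apply, Complex.normSq_apply]
  simp only [sq]

/-- The open core of `K`, where the choice is forced. -/
def InCore (x y : ℝ) : Prop :=
  x ^ 2 + y ^ 2 < 1 ∧ 2 * x < x ^ 2 + y ^ 2 ∧ -1 / 2 < y ∧ y < 1 / 2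

/-- Let w be the remainder. If |w - 1| < 1 then Re w > 0, so h + 1 is admissible and strictly
better. If Im w > 1/2 or Im w < -1/2, then h + i or h - i respectively is. -/
theorem IsShiftedHurwitz.inK {c : ℂ → GaussianInt} (hc : IsShiftedHurwitz c) {z : ℂ} (hz : z ≠ 0) :
    InK (z - c z : ℂ).re (z - c z : ℂ).im := by
  obtain ⟨h1, h2⟩ := hc z hz
  have key : ∀ h : GaussianInt, ‖z - (c z : ℂ) - (h : ℂ)‖ ≤ 1 →
      ‖z - (c z : ℂ) - (-1 / 2)‖ ≤ ‖z - (c z : ℂ) - (h : ℂ) - (-1 / 2)‖ := by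
    intro h hh
    have := h2 (c z + h) (by rw [GaussianInt.toComplex_add, ← sub_sub]; exact hh)
    rwa [GaussianInt.toComplex_add, ← sub_sub] at this
  generalize z - (c z : ℂ) = w at *
  have k1 := key 1
  have k2 := key ⟨0, 1⟩
  have k3 := key ⟨0, -1⟩
  simp only [norm_le_one_iff, norm_le_norm_iff, GaussianInt.toComplex_def] at *
  norm_num at *
  refine ⟨?_, ?_, ?_, ?_⟩ <;> simp only [quad]
  · linarith
  · by_contra! hcon
    have := k1 (by linarith)
    nlinarith [sq_nonneg w.re, sq_nonneg w.im]
  · by_contra! hcon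
    have := k3 (by linarith)
    linarith
  · by_contra! hcon
    have := k2 (by linarith)
    linarith

/-- Write the choice as a + n + mi. Since |Im| < 1/2, a nonzero m strictly increases |Im|. A
negative n moves away from -1/2, n = 1 is inadmissible because |z - 1| > 1, and n ≥ 2 leaves the
unit disc. -/
theorem IsShiftedHurwitz.eq_of_inCore {c : ℂ → GaussianInt} (hc : IsShiftedHurwitz c) {w : ℂ}
    (hw : w ≠ 0) {a : GaussianInt} (h : InCore (w - a : ℂ).re (w - a : ℂ).im) : c w = a := by
  obtain ⟨h1, h2, h3, h4⟩ := h
  obtain ⟨c1, c2⟩ := hc w hw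
  have c2 := c2 a (by rw [norm_le_one_iff]; exact h1.le)
  obtain ⟨b, hb⟩ : ∃ b, c w = a + b := ⟨c w - a, by ring⟩
  rw [hb, GaussianInt.toComplex_add, ← sub_sub] at c1 c2
  generalize w - (a : ℂ) = z at *
  suffices b = 0 by rw [hb, this, add_zero]
  obtain ⟨n, m⟩ := b
  simp only [norm_le_one_iff, norm_le_norm_iff, GaussianInt.toComplex_def] at *
  norm_num at *
  have hm : z.im ^ 2 ≤ (z.im - m) ^ 2 ∧ (z.im ^ 2 = (z.im - m) ^ 2 → m = 0) := by
    rcases lt_trichotomy m 0 with hm | rfl | hm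
    · have : (m : ℝ) ≤ -1 := by exact_mod_cast (by lia : m ≤ -1)
      exact ⟨by nlinarith, fun h => by nlinarith⟩
    · simp
    · have : (1 : ℝ) ≤ m := by exact_mod_cast (by lia : 1 ≤ m)
      exact ⟨by nlinarith, fun h => by nlinarith⟩
  have hx : -1 < z.re := by nlinarith [sq_nonneg z.im]
  have hx' : z.re < 1 / 7 := by
    by_contra! hc
    nlinarith
  have hn : n = 0 := by
    rcases lt_trichotomy n 0 with hn | rfl | hn
    · have : (n : ℝ) ≤ -1 := by exact_mod_cast (by lia : n ≤ -1)
      nlinarith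
    · rfl
    · rcases (show n = 1 ∨ 2 ≤ n by lia) with rfl | hn2
      · push_cast at *
        nlinarith
      · have : (2 : ℝ) ≤ n := by exact_mod_cast hn2
        nlinarith
  subst hn
  have := hm.2 (by push_cast at *; linarith)
  subst this
  rfl

theorem isClosed_inK : IsClosed {z : ℂ | InK z.re z.im} := by
  have : ∀ a b c d : ℝ, IsClosed {z : ℂ | 0 ≤ quad a b c d z.re z.im} := by
    intro a b c d
    refine isClosed_le continuous_const ?_
    simp only [quad]
    fun_prop
  exact (this _ _ _ _).inter <| (this _ _ _ _).inter <| (this _ _ _ _).inter (this _ _ _ _)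

/-- Moving a point of `K` towards `-1 / 2` brings it into the core. -/
theorem InK.inCore_of_lt {x y t : ℝ} (h : InK x y) (ht : 0 < t) (ht' : t < 1) :
    InCore (x - t * (x + 1 / 2)) (y - t * y) := by
  obtain ⟨k1, k2, k3, k4, k5, k6⟩ := h.bounds
  have hy : y ^ 2 ≤ 1 / 4 := by nlinarith
  refine ⟨?_, ?_, ?_, ?_⟩
  · have e : (x - t * (x + 1 / 2)) ^ 2 + (y - t * y) ^ 2 = (1 - t) * (x ^ 2 + y ^ 2) + t / 4
      - t * (1 - t) * ((x + 1 / 2) ^ 2 + y ^ 2) := by ring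
    rw [e]
    have : 0 ≤ t * (1 - t) * ((x + 1 / 2) ^ 2 + y ^ 2) := by
      have : 0 < 1 - t := by linarith
      positivity
    nlinarith
  -- The exterior of the disc about 1 is not convex, so this inequality needs its own argument: left
  -- of the imaginary axis it is clear; otherwise 0 ≤ x ≤ 1/7, and the term linear in t is positive
  -- because x² + y² < 1/2.
  · rcases lt_or_ge (x - t * (x + 1 / 2)) 0 with hx | hx
    · nlinarith [sq_nonneg (x - t * (x + 1 / 2)), sq_nonneg (y - t * y)]
    · have hx0 : 0 ≤ x := by nlinarith
      have hD : 0 < 1 / 2 + x / 2 - x ^ 2 - y ^ 2 := by nlinarith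
      have e : (x - t * (x + 1 / 2)) ^ 2 + (y - t * y) ^ 2 - 2 * (x - t * (x + 1 / 2)) =
        x ^ 2 + y ^ 2 - 2 * x + 2 * t * (1 / 2 + x / 2 - x ^ 2 - y ^ 2)
          + t ^ 2 * ((x + 1 / 2) ^ 2 + y ^ 2) := by ring
      have p1 : 0 < 2 * t * (1 / 2 + x / 2 - x ^ 2 - y ^ 2) := by positivity
      have p2 : 0 ≤ t ^ 2 * ((x + 1 / 2) ^ 2 + y ^ 2) := by positivity
      linarith
  · nlinarith
  · nlinarith

/-- A core point has ⟨w⟩ = 0 and is its own remainder. Every point of K is a limit of core points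
along the segment to -1/2. -/
theorem IsShiftedHurwitz.fundamentalSet_eq {c : ℂ → GaussianInt} (hc : IsShiftedHurwitz c) :
    fundamentalSet c = {z : ℂ | InK z.re z.im} := by
  apply Subset.antisymm
  · refine closure_minimal ?_ isClosed_inK
    rintro _ ⟨z, hz, rfl⟩
    exact hc.inK hz
  · intro z hz
    have hlim : Filter.Tendsto (fun t : ℝ => z - t * (z + 1 / 2)) (nhdsWithin 0 (Ioi 0)) (nhds z) := by
      have : Continuous fun t : ℝ => z - t * (z + 1 / 2) := by fun_prop
      have := (this.tendsto 0).mono_left (nhdsWithin_le_nhds (s := Ioi 0))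
      simpa using this
    have hcore : ∀ w : ℂ, InCore w.re w.im → w ∈ fundamentalSet c := by
      intro w hw
      have hw0 : w ≠ 0 := by
        rintro rfl
        simp [InCore] at hw
      refine subset_closure ⟨w, hw0, ?_⟩
      rw [hc.eq_of_inCore hw0 (a := 0) (by simpa using hw)]
      simp
    have : z ∈ closure (fundamentalSet c) := by
      refine mem_closure_of_tendsto hlim ?_
      filter_upwards [Ioo_mem_nhdsGT (zero_lt_one' ℝ)] with t ht
      apply hcore
      have := InK.inCore_of_lt hz ht.1 ht.2
      simpa using this
    rwa [fundamentalSet, closure_closure] at this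

/-! ### Inversion and conjugation of the pieces -/

theorem mem_upperPiece {i : ℕ} {z : ℂ} :
    z ∈ upperPiece {z : ℂ | InK z.re z.im} i ↔ InUpper i z.re z.im := by
  unfold upperPiece InUpper
  split <;>
    simp only [mem_ofPred_eq, norm_le_one_iff, one_le_norm_iff, mem_empty_iff_false, quad,
      Complex.sub_re, Complex.sub_im, Complex.add_re, Complex.add_im, Complex.neg_re,
      Complex.neg_im, Complex.I_re, Complex.I_im, Complex.one_re, Complex.one_im] <;>
    try generalize InK z.re z.im = P
  all_goals constructor <;> intro H <;> casesm* _ ∧ _ <;> repeat' apply And.intro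
  all_goals first | assumption | linarith

theorem mem_piece {i : ℕ} {z : ℂ} :
    z ∈ piece {z : ℂ | InK z.re z.im} i ↔ InPiece i z.re z.im := by
  unfold piece InPiece
  split_ifs with h
  · exact mem_upperPiece
  · rw [show z.re = ((starRingEnd ℂ) z).re by simp, show -z.im = ((starRingEnd ℂ) z).im by simp,
      ← mem_upperPiece]
    constructor
    · rintro ⟨w, hw, rfl⟩
      simpa using hw
    · intro h
      exact ⟨_, h, by simp⟩

theorem S_S (z : ℂ) : S (S z) = z := by
  simp only [S]
  rcases eq_or_ne z 0 with rfl | h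
  · simp
  · field_simp

theorem S_ne_zero {z : ℂ} (h : z ≠ 0) : S z ≠ 0 := by
  simpa [S] using h

/-- As S(w) = (-u + iv)/|w|², clearing the positive factor |w|² exchanges a with d and flips the
sign of b. -/
theorem quad_S {a b c d : ℝ} {w : ℂ} (hw : w ≠ 0) :
    0 ≤ quad a b c d (S w).re (S w).im ↔ 0 ≤ quad d (-b) c a w.re w.im := by
  have hN : 0 < w.re ^ 2 + w.im ^ 2 := by
    have := Complex.normSq_pos.2 hw
    rw [Complex.normSq_apply] at this
    linarith
  have e1 : (S w).re = -w.re / (w.re ^ 2 + w.im ^ 2) := by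
    simp [S, Complex.div_re, Complex.normSq_apply, sq]
  have e2 : (S w).im = w.im / (w.re ^ 2 + w.im ^ 2) := by
    simp [S, Complex.normSq_apply, sq, neg_div]
  have : quad a b c d (S w).re (S w).im =
      quad d (-b) c a w.re w.im / (w.re ^ 2 + w.im ^ 2) := by
    rw [e1, e2]
    simp only [quad]
    field_simp
    ring
  rw [this, le_div_iff₀ hN, zero_mul]

theorem InSUpper.one_le {i : ℕ} {u v : ℝ} (h : InSUpper i u v) : 1 ≤ u ^ 2 + v ^ 2 := by
  unfold InSUpper at h
  split at h <;> first | exact h.1.1 | exact h.elim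

theorem inUpper_S {i : ℕ} {w : ℂ} (hw : w ≠ 0) :
    InUpper i (S w).re (S w).im ↔ InSUpper i w.re w.im := by
  unfold InUpper InSUpper
  split <;> simp only [InK, InSK, quad_S hw] <;> simp only [quad] <;>
    constructor <;> intro H <;> casesm* _ ∧ _ <;> repeat' apply And.intro
  all_goals linarith

theorem S_image_upperPiece {i : ℕ} (hi : i ∈ Finset.Icc 1 6) :
    S '' (upperPiece {z : ℂ | InK z.re z.im} i \ {0}) =
      ⋃ p ∈ upperTranslates i,
        (fun z : ℂ => (p.1 : ℂ) + z) '' piece {z : ℂ | InK z.re z.im} p.2 := by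
  have h1 : ∀ w, w ∈ S '' (upperPiece {z : ℂ | InK z.re z.im} i \ {0}) ↔
      InSUpper i w.re w.im := by
    intro w
    constructor
    · rintro ⟨z, ⟨hz, hz0⟩, rfl⟩
      rw [← inUpper_S (S_ne_zero hz0), S_S]
      exact mem_upperPiece.1 hz
    · intro h
      have hw : w ≠ 0 := by
        rintro rfl
        have := h.one_le
        norm_num at this
      exact ⟨S w, ⟨mem_upperPiece.2 ((inUpper_S hw).2 h), S_ne_zero hw⟩, S_S w⟩
  ext w
  rw [h1, inSUpper_iff_covered hi]
  simp only [mem_iUnion]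
  constructor
  · rintro ⟨n, m, j, hj, hP⟩
    refine ⟨_, hj, w - (⟨n, m⟩ : GaussianInt), mem_piece.2 ?_, by simp⟩
    simpa [GaussianInt.toComplex_def] using hP
  · rintro ⟨⟨⟨n, m⟩, j⟩, hj, z, hz, rfl⟩
    refine ⟨n, m, j, hj, ?_⟩
    simpa [GaussianInt.toComplex_def] using mem_piece.1 hz

theorem conj_S (z : ℂ) : (starRingEnd ℂ) (S z) = S ((starRingEnd ℂ) z) := by
  simp [S]

theorem conj_image_piece {j : ℕ} (hj : j ∈ Finset.Icc 1 10) :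
    (starRingEnd ℂ) '' piece {z : ℂ | InK z.re z.im} j =
      piece {z : ℂ | InK z.re z.im} (conjIndex j) := by
  ext z
  rw [mem_piece, InPiece.conj hj]
  constructor
  · rintro ⟨w, hw, rfl⟩
    simpa using mem_piece.1 hw
  · intro h
    exact ⟨(starRingEnd ℂ) z, mem_piece.2 (by simpa using h), by simp⟩

theorem S_image_piece {i : ℕ} (hi : i ∈ Finset.Icc 1 10) :
    S '' (piece {z : ℂ | InK z.re z.im} i \ {0}) =
      ⋃ p ∈ translates i,
        (fun z : ℂ => (p.1 : ℂ) + z) '' piece {z : ℂ | InK z.re z.im} p.2 := by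
  obtain ⟨a, b⟩ := Finset.mem_Icc.1 hi
  rcases le_or_gt i 6 with h6 | h6
  · simp only [piece, translates, if_pos h6]
    exact S_image_upperPiece (Finset.mem_Icc.2 ⟨a, h6⟩)
  · have h6' : ¬ i ≤ 6 := not_le.2 h6
    have e : S '' (piece {z : ℂ | InK z.re z.im} i \ {0}) = (starRingEnd ℂ) ''
        (S '' (upperPiece {z : ℂ | InK z.re z.im} (i - 5) \ {0})) := by
      rw [image_image]
      simp only [conj_S]
      rw [← image_image S (starRingEnd ℂ), piece, if_neg h6',
        image_sdiff (starRingEnd ℂ).injective, image_singleton, map_zero]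
    rw [e, S_image_upperPiece (Finset.mem_Icc.2 ⟨by lia, by lia⟩), translates, if_neg h6']
    simp only [image_iUnion, biUnion_image]
    refine iUnion₂_congr fun p hp => ?_
    rw [← conj_image_piece (mem_Icc_of_mem_upperTranslates (a := p.1) hp), image_image, image_image]
    simp only [map_add, GaussianInt.toComplex_star]

/-! ### Null boundaries and the partition -/

theorem volume_circle (b c d : ℝ) :
    volume {z : ℂ | z.re ^ 2 + z.im ^ 2 + b * z.re + c * z.im + d = 0} = 0 := by
  refine measure_mono_null ?_ (Measure.addHaar_sphere volume (⟨-b / 2, -c / 2⟩ : ℂ)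
    (Real.sqrt (b ^ 2 / 4 + c ^ 2 / 4 - d)))
  intro z hz
  have hz : z.re ^ 2 + z.im ^ 2 + b * z.re + c * z.im + d = 0 := hz
  rw [mem_sphere_iff_norm, Complex.norm_eq_sqrt_sq_add_sq]
  -- No sign condition on the radicand is needed: on the given set it equals a sum of squares.
  congr 1
  simp only [Complex.sub_re, Complex.sub_im]
  linarith

/-- Convex sets have null frontier, which covers lines and the degenerate case b = c = 0 at once. -/
theorem convex_linear (b c d : ℝ) : Convex ℝ {z : ℂ | 0 ≤ b * z.re + c * z.im + d} := by
  intro z hz w hw s t hs ht hst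
  have hz : 0 ≤ b * z.re + c * z.im + d := hz
  have hw : 0 ≤ b * w.re + c * w.im + d := hw
  have e : b * (s • z + t • w).re + c * (s • z + t • w).im + d =
      s * (b * z.re + c * z.im + d) + t * (b * w.re + c * w.im + d) := by
    simp only [Complex.add_re, Complex.add_im, Complex.smul_re, Complex.smul_im, smul_eq_mul]
    linear_combination (-d) * hst
  rw [mem_ofPred_eq, e]
  positivity

theorem volume_re_eq (a : ℝ) : volume {z : ℂ | z.re = a} = 0 := by
  rw [← Complex.frontier_setOfPred_le_re]
  exact (convex_halfSpace_re_ge a).addHaar_frontier _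

theorem volume_im_eq (a : ℝ) : volume {z : ℂ | z.im = a} = 0 := by
  rw [← Complex.frontier_setOfPred_le_im]
  exact (convex_halfSpace_im_ge a).addHaar_frontier _

/-- Closed sets with boundaries of measure zero. -/
def NullFrontier (s : Set ℂ) : Prop := IsClosed s ∧ volume (frontier s) = 0

theorem NullFrontier.and {p q : ℂ → Prop} (hp : NullFrontier {z | p z})
    (hq : NullFrontier {z | q z}) : NullFrontier {z | p z ∧ q z} := by
  refine ⟨hp.1.inter hq.1, measure_mono_null ?_ (measure_union_null hp.2 hq.2)⟩
  exact (frontier_inter_subset _ _).trans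
    (union_subset_union inter_subset_left inter_subset_right)

theorem nullFrontier_quad (a b c d : ℝ) : NullFrontier {z : ℂ | 0 ≤ quad a b c d z.re z.im} := by
  have hcont : Continuous fun z : ℂ => quad a b c d z.re z.im := by
    simp only [quad]
    fun_prop
  refine ⟨isClosed_le continuous_const hcont, ?_⟩
  rcases eq_or_ne a 0 with rfl | ha
  · simp only [quad, zero_mul, zero_add]
    exact (convex_linear b c d).addHaar_frontier _
  · refine measure_mono_null (frontier_le_subset_eq continuous_const hcont)
      (measure_mono_null ?_ (volume_circle (b / a) (c / a) (d / a)))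
    intro z hz
    have hz : 0 = quad a b c d z.re z.im := hz
    have e : z.re ^ 2 + z.im ^ 2 + b / a * z.re + c / a * z.im + d / a =
        quad a b c d z.re z.im / a := by
      simp only [quad]
      field_simp
    change _ = (0 : ℝ)
    rw [e, ← hz, zero_div]

theorem nullFrontier_inPiece {j : ℕ} (hj : j ∈ Finset.Icc 1 10) :
    NullFrontier {z : ℂ | InPiece j z.re z.im} := by
  have hneg : ∀ a b c d x y : ℝ, quad a b c d x (-y) = quad a b (-c) d x y := by
    intros
    simp only [quad]
    ring
  obtain ⟨a, b⟩ := Finset.mem_Icc.1 hj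
  interval_cases j <;>
    simp only [InPiece, InUpper, InK, Nat.reduceLeDiff, Nat.reduceSub, if_true, if_false, hneg] <;>
    repeat' apply NullFrontier.and
  all_goals exact nullFrontier_quad _ _ _ _

/-- The curves that separate the pieces. -/
def OnCurve (x y : ℝ) : Prop :=
  x = -1 / 2 ∨ y = 0 ∨ x ^ 2 + y ^ 2 = -2 * x ∨ x ^ 2 + y ^ 2 = 2 * y ∨ x ^ 2 + y ^ 2 = -2 * y ∨
    (x + 1) ^ 2 + (y - 1) ^ 2 = 1 ∨ (x + 1) ^ 2 + (y + 1) ^ 2 = 1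

theorem volume_onCurve : volume {z : ℂ | OnCurve z.re z.im} = 0 := by
  simp only [OnCurve, ofPred_or]
  have hcirc : ∀ (b c d : ℝ) (p : ℂ → Prop),
      (∀ z : ℂ, p z → z.re ^ 2 + z.im ^ 2 + b * z.re + c * z.im + d = 0) →
      volume {z | p z} = 0 := fun b c d p h => measure_mono_null h (volume_circle b c d)
  refine measure_union_null (volume_re_eq _) <| measure_union_null (volume_im_eq _) <|
    measure_union_null (hcirc 2 0 0 _ ?_) <| measure_union_null (hcirc 0 (-2) 0 _ ?_) <|
    measure_union_null (hcirc 0 2 0 _ ?_) <| measure_union_null (hcirc 2 (-2) 1 _ ?_)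
    (hcirc 2 2 1 _ ?_) <;>
  · intro z h
    linarith

/-- For each pair of pieces, `Bounds` implies opposite inequalities for some separating curve,
forcing equality there. -/
theorem onCurve_of_lt {i j : ℕ} (hi : i ∈ Finset.Icc 1 10) (hj : j ∈ Finset.Icc 1 10)
    (hij : i < j) {x y : ℝ} (h : InPiece i x y) (h' : InPiece j x y) : OnCurve x y := by
  replace h := h.bounds hi
  replace h' := h'.bounds hj
  obtain ⟨a, b⟩ := Finset.mem_Icc.1 hi
  obtain ⟨a', b'⟩ := Finset.mem_Icc.1 hj
  unfold OnCurve
  clear hi hj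
  interval_cases i <;> interval_cases j <;> simp only [Bounds] at h h' <;> casesm* _ ∧ _ <;>
  first
  | exact .inl (le_antisymm (by linarith) (by linarith))
  | exact .inr <| .inl (le_antisymm (by linarith) (by linarith))
  | exact .inr <| .inr <| .inl (le_antisymm (by linarith) (by linarith))
  | exact .inr <| .inr <| .inr <| .inl (le_antisymm (by linarith) (by linarith))
  | exact .inr <| .inr <| .inr <| .inr <| .inl (le_antisymm (by linarith) (by linarith))
  | exact .inr <| .inr <| .inr <| .inr <| .inr <| .inl (le_antisymm (by linarith) (by linarith))
  | exact .inr <| .inr <| .inr <| .inr <| .inr <| .inr (le_antisymm (by linarith) (by linarith))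

theorem onCurve_of_ne {i j : ℕ} (hi : i ∈ Finset.Icc 1 10) (hj : j ∈ Finset.Icc 1 10)
    (hij : i ≠ j) {x y : ℝ} (h : InPiece i x y) (h' : InPiece j x y) : OnCurve x y := by
  rcases lt_or_gt_of_ne hij with hlt | hlt
  · exact onCurve_of_lt hi hj hlt h h'
  · exact onCurve_of_lt hj hi hlt h' h

theorem exists_inPiece_not_onCurve {j : ℕ} (hj : j ∈ Finset.Icc 1 10) :
    ∃ x y, InPiece j x y ∧ ¬ OnCurve x y := by
  obtain ⟨a, b⟩ := Finset.mem_Icc.1 hj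
  interval_cases j
  -- The real axis counts as a separating curve, so the sample points of K_1 and K_6 sit slightly
  -- above it.
  · exact ⟨-1 / 4, 1 / 100, by norm_num [InPiece, InUpper, InK, quad], by norm_num [OnCurve]⟩
  · exact ⟨-1 / 4, 1 / 10, by norm_num [InPiece, InUpper, InK, quad], by norm_num [OnCurve]⟩
  · exact ⟨0, 1 / 4, by norm_num [InPiece, InUpper, InK, quad], by norm_num [OnCurve]⟩
  · exact ⟨-2 / 5, 2 / 5, by norm_num [InPiece, InUpper, InK, quad], by norm_num [OnCurve]⟩
  · exact ⟨-3 / 5, 2 / 5, by norm_num [InPiece, InUpper, InK, quad], by norm_num [OnCurve]⟩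
  · exact ⟨-3 / 4, 1 / 100, by norm_num [InPiece, InUpper, InK, quad], by norm_num [OnCurve]⟩
  · exact ⟨-1 / 4, -1 / 10, by norm_num [InPiece, InUpper, InK, quad], by norm_num [OnCurve]⟩
  · exact ⟨0, -1 / 4, by norm_num [InPiece, InUpper, InK, quad], by norm_num [OnCurve]⟩
  · exact ⟨-2 / 5, -2 / 5, by norm_num [InPiece, InUpper, InK, quad], by norm_num [OnCurve]⟩
  · exact ⟨-3 / 5, -2 / 5, by norm_num [InPiece, InUpper, InK, quad], by norm_num [OnCurve]⟩

theorem succ_mem_Icc (i : Fin 10) : (i : ℕ) + 1 ∈ Finset.Icc 1 10 :=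
  Finset.mem_Icc.2 ⟨by lia, by lia⟩

theorem piece_eq (j : ℕ) :
    piece {z : ℂ | InK z.re z.im} j = {z : ℂ | InPiece j z.re z.im} :=
  ext fun _ => mem_piece

/-- Overlaps lie on the null set of curves: an off-curve point of one piece distinguishes it from
the others, and an open null intersection of interiors is empty. -/
theorem isFinitePartition_piece :
    IsFinitePartition {z : ℂ | InK z.re z.im}
      (fun i : Fin 10 => piece {z : ℂ | InK z.re z.im} (i + 1)) where
  injective i j hij := by
    by_contra hne
    obtain ⟨x, y, hP, hC⟩ := exists_inPiece_not_onCurve (succ_mem_Icc i)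
    have hij : piece {z : ℂ | InK z.re z.im} (i + 1) = piece {z : ℂ | InK z.re z.im} (j + 1) := hij
    have h1 : (⟨x, y⟩ : ℂ) ∈ piece {z : ℂ | InK z.re z.im} (i + 1) := mem_piece.2 hP
    rw [hij] at h1
    exact hC (onCurve_of_ne (succ_mem_Icc i) (succ_mem_Icc j)
      (by simpa [Fin.val_inj] using hne) hP (mem_piece.1 h1))
  nonempty i := by
    obtain ⟨x, y, hP, -⟩ := exists_inPiece_not_onCurve (succ_mem_Icc i)
    exact ⟨⟨x, y⟩, mem_piece.2 hP⟩
  closed i := by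
    rw [piece_eq]
    exact (nullFrontier_inPiece (succ_mem_Icc i)).1
  null_frontier i := by
    rw [piece_eq]
    exact (nullFrontier_inPiece (succ_mem_Icc i)).2
  cover := by
    ext z
    simp only [mem_iUnion, mem_piece]
    constructor
    · rintro ⟨i, hi⟩
      exact hi.inK
    · intro hz
      obtain ⟨j, hj, hP⟩ := InK.exists_inPiece hz
      obtain ⟨a, b⟩ := Finset.mem_Icc.1 hj
      refine ⟨⟨j - 1, by lia⟩, ?_⟩
      rwa [show ((⟨j - 1, by lia⟩ : Fin 10) : ℕ) + 1 = j by simp; lia]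
  disjoint_interior i j hij := by
    rw [disjoint_iff_inter_eq_empty]
    refine (isOpen_interior.inter isOpen_interior).eq_empty_of_measure_zero (μ := volume)
      (measure_mono_null ?_ volume_onCurve)
    rintro z ⟨h1, h2⟩
    exact onCurve_of_ne (succ_mem_Icc i) (succ_mem_Icc j) (by simpa [Fin.val_inj] using hij)
      (mem_piece.1 (interior_subset h1)) (mem_piece.1 (interior_subset h2))

/-! ### Building G(K_i) from the pieces -/

theorem volume_inK_not_inCore : volume {z : ℂ | InK z.re z.im ∧ ¬ InCore z.re z.im} = 0 := by
  refine measure_mono_null ?_ (measure_union_null (volume_circle 0 0 (-1)) <|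
    measure_union_null (volume_circle (-2) 0 0) <|
    measure_union_null (volume_im_eq (-1 / 2)) (volume_im_eq (1 / 2)))
  rintro z ⟨hK, hC⟩
  obtain ⟨k1, k2, k3, k4, -⟩ := hK.bounds
  contrapose! hC
  simp only [mem_union, mem_ofPred_eq, not_or] at hC
  obtain ⟨c1, c2, c3, c4⟩ := hC
  exact ⟨lt_of_le_of_ne k1 fun h => c1 (by linarith), lt_of_le_of_ne k2 fun h => c2 (by linarith),
    lt_of_le_of_ne k3 (Ne.symm c3), lt_of_le_of_ne k4 c4⟩

theorem snd_mem_Icc_of_mem_translates {i : ℕ} {p : GaussianInt × ℕ} (h : p ∈ translates i) :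
    p.2 ∈ Finset.Icc 1 10 := by
  unfold translates at h
  split at h
  · exact mem_Icc_of_mem_upperTranslates (a := p.1) h
  · obtain ⟨q, hq, rfl⟩ := h
    obtain ⟨a, b⟩ := Finset.mem_Icc.1 (mem_Icc_of_mem_upperTranslates (a := q.1) hq)
    simp only [Finset.mem_Icc, conjIndex]
    split_ifs <;> lia

theorem countable_gaussianInt : Countable GaussianInt :=
  Function.Injective.countable (f := fun a : GaussianInt => (a.re, a.im)) fun a b h => by
    simpa [Zsqrtd.ext_iff] using h

theorem IsShiftedHurwitz.isBuildable {c : ℂ → GaussianInt} (hc : IsShiftedHurwitz c) {i : ℕ}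
    (hi : i ∈ Finset.Icc 1 10) :
    IsBuildable (range fun i : Fin 10 => piece {z : ℂ | InK z.re z.im} (i + 1))
      (gaussMap c '' piece {z : ℂ | InK z.re z.im} i) := by
  have := countable_gaussianInt
  refine ⟨(fun p : GaussianInt × ℕ => piece {z : ℂ | InK z.re z.im} p.2) '' translates i, ?_, ?_⟩
  · rintro _ ⟨p, hp, rfl⟩
    obtain ⟨a, b⟩ := Finset.mem_Icc.1 (snd_mem_Icc_of_mem_translates hp)
    refine ⟨⟨p.2 - 1, by lia⟩, ?_⟩
    simp only
    rw [Nat.sub_add_cancel a]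
  rw [ae_eq_set]
  constructor
  -- Exceptional values of G: the value at 0, and Gaussian translates of the non-core part of K, a
  -- countable union of null sets.
  · have hnull : volume ({0} ∪ ⋃ a : GaussianInt, (fun z : ℂ => (a : ℂ) + z) ⁻¹'
        {z : ℂ | InK z.re z.im ∧ ¬ InCore z.re z.im}) = 0 := by
      refine measure_union_null (measure_singleton 0) (measure_iUnion_null fun a => ?_)
      rw [measure_preimage_add]
      exact volume_inK_not_inCore
    refine measure_mono_null ?_ hnull
    rintro _ ⟨⟨z, hz, rfl⟩, hg⟩
    rcases eq_or_ne z 0 with rfl | hz0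
    · simp [gaussMap]
    right
    have hS : S z ∈ S '' (piece {z : ℂ | InK z.re z.im} i \ {0}) := ⟨z, ⟨hz, hz0⟩, rfl⟩
    rw [S_image_piece hi] at hS
    simp only [mem_iUnion] at hS
    obtain ⟨p, hp, y, hy, hyw⟩ := hS
    have hy' : S z - p.1 = y := by rw [← hyw]; ring
    have hgm : gaussMap c z = S z - c (S z) := by rw [gaussMap, if_neg hz0]
    by_cases hC : InCore y.re y.im
    · rw [← hy'] at hC
      refine (hg ⟨_, ⟨p, hp, rfl⟩, ?_⟩).elim
      rw [hgm, hc.eq_of_inCore (S_ne_zero hz0) hC, hy']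
      exact hy
    -- G(z) and y are both congruent to S(z) modulo the Gaussian integers, so their difference is
    -- the required translation.
    · refine mem_iUnion.2 ⟨c (S z) - p.1, ?_⟩
      have e : ((c (S z) - p.1 : GaussianInt) : ℂ) + gaussMap c z = y := by
        rw [hgm, ← hy', GaussianInt.toComplex_sub]
        ring
      rw [mem_preimage, e]
      exact ⟨(mem_piece.1 hy).inK, hC⟩
  · refine measure_mono_null ?_ volume_inK_not_inCore
    rintro y ⟨⟨_, ⟨p, hp, rfl⟩, hy⟩, hg⟩
    refine ⟨(mem_piece.1 hy).inK, fun hC => hg ?_⟩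
    -- Conversely, a core point y of a listed piece is attained: a + y is S(z) for some z in K_i,
    -- and the forced choice there is a.
    have hS : (p.1 : ℂ) + y ∈ S '' (piece {z : ℂ | InK z.re z.im} i \ {0}) := by
      rw [S_image_piece hi]
      exact mem_iUnion₂.2 ⟨p, hp, y, hy, rfl⟩
    obtain ⟨z, ⟨hz, hz0⟩, hzS⟩ := hS
    refine ⟨z, hz, ?_⟩
    have hy' : S z - p.1 = y := by rw [hzS]; ring
    rw [← hy'] at hC
    have hz0 : z ≠ 0 := hz0
    rw [gaussMap, if_neg hz0, hc.eq_of_inCore (S_ne_zero hz0) hC, hy']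

/-! ### Existence of the choice, by minimising over a finite nonempty set -/

theorem finite_norm_sub_le (z : ℂ) : {h : GaussianInt | ‖z - (h : ℂ)‖ ≤ 1}.Finite := by
  have hfin : ((Icc (⌊z.re⌋ - 1) (⌈z.re⌉ + 1)) ×ˢ (Icc (⌊z.im⌋ - 1) (⌈z.im⌉ + 1))).Finite :=
    (finite_Icc _ _).prod (finite_Icc _ _)
  refine Finite.of_finite_image (f := fun a : GaussianInt => (a.re, a.im)) (hfin.subset ?_) ?_
  · rintro _ ⟨h, hh, rfl⟩
    have hre := (abs_le.1 ((Complex.abs_re_le_norm _).trans hh))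
    have him := (abs_le.1 ((Complex.abs_im_le_norm _).trans hh))
    simp only [Complex.sub_re, Complex.sub_im, ← GaussianInt.intCast_re,
      ← GaussianInt.intCast_im] at hre him
    have f1 := Int.floor_le z.re
    have f2 := Int.le_ceil z.re
    have f3 := Int.floor_le z.im
    have f4 := Int.le_ceil z.im
    refine ⟨⟨?_, ?_⟩, ⟨?_, ?_⟩⟩ <;> rify <;> linarith
  · intro a _ b _ h
    simpa [Zsqrtd.ext_iff] using h

/-- The covering by translates of K already provides an admissible Gaussian integer, since K lies in
the unit disc. -/
theorem exists_norm_sub_le (z : ℂ) : ∃ h : GaussianInt, ‖z - (h : ℂ)‖ ≤ 1 := by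
  obtain ⟨m, hm, hm'⟩ := exists_row z.im
  obtain ⟨n, hn, -⟩ := exists_sub_inK (u := z.re) hm hm'.le
  refine ⟨⟨n, m⟩, ?_⟩
  rw [norm_le_one_iff]
  simpa [GaussianInt.toComplex_def] using hn.bounds.1

theorem exists_isShiftedHurwitz : ∃ c : ℂ → GaussianInt, IsShiftedHurwitz c := by
  have key : ∀ z : ℂ, ∃ h : GaussianInt, ‖z - (h : ℂ)‖ ≤ 1 ∧
      ∀ h' : GaussianInt, ‖z - (h' : ℂ)‖ ≤ 1 →
        ‖z - (h : ℂ) - (-1 / 2)‖ ≤ ‖z - (h' : ℂ) - (-1 / 2)‖ := by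
    intro z
    obtain ⟨h, hh, hmin⟩ := exists_min_image _ (fun h : GaussianInt => ‖z - (h : ℂ) - (-1 / 2)‖)
      (finite_norm_sub_le z) (exists_norm_sub_le z)
    exact ⟨h, hh, hmin⟩
  choose c hc using key
  exact ⟨c, fun z _ => hc z⟩

theorem zero_mem_fundamentalSet {c : ℂ → GaussianInt} (hc : IsShiftedHurwitz c) :
    (0 : ℂ) ∈ fundamentalSet c := by
  rw [hc.fundamentalSet_eq]
  norm_num [InK, quad]

theorem mapsTo_gaussMap {c : ℂ → GaussianInt} (hc : IsShiftedHurwitz c) :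
    MapsTo (gaussMap c) (fundamentalSet c) (fundamentalSet c) := by
  intro z _
  rw [gaussMap]
  split_ifs with hz
  · exact zero_mem_fundamentalSet hc
  · exact subset_closure ⟨S z, S_ne_zero hz, rfl⟩

end ComplexCF

theorem mainTheorem12 :
    (∃ c : ℂ → GaussianInt, ComplexCF.IsShiftedHurwitz c) ∧
    ∀ c : ℂ → GaussianInt, ComplexCF.IsShiftedHurwitz c →
      ComplexCF.IsChoiceFunction c ∧
      MapsTo (ComplexCF.gaussMap c) (ComplexCF.fundamentalSet c) (ComplexCF.fundamentalSet c) ∧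
      ComplexCF.FiniteBuildingPropertyWith c
        (fun i : Fin 10 => ComplexCF.piece (ComplexCF.fundamentalSet c) (i + 1)) ∧
      ∀ i ∈ Finset.Icc 1 10,
        ComplexCF.S '' (ComplexCF.piece (ComplexCF.fundamentalSet c) i \ {0}) =
          ⋃ p ∈ ComplexCF.translates i,
            (fun z : ℂ => (p.1 : ℂ) + z) '' ComplexCF.piece (ComplexCF.fundamentalSet c) p.2 := by
  refine ⟨ComplexCF.exists_isShiftedHurwitz, fun c hc => ⟨fun z hz => (hc z hz).1,
    ComplexCF.mapsTo_gaussMap hc, ?_, ?_⟩⟩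
  · refine ⟨by norm_num, ?_, fun i => ?_⟩
    · rw [hc.fundamentalSet_eq]
      exact ComplexCF.isFinitePartition_piece
    · rw [hc.fundamentalSet_eq]
      exact hc.isBuildable (ComplexCF.succ_mem_Icc i)
  · rw [hc.fundamentalSet_eq]
    exact fun i hi => ComplexCF.S_image_piece hi
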